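/- **Setting.** A multi-objective MDP $\mathcal M=(\mathcal S,\mathcal A,P,\gamma,\mathbf R)$ has finite nonempty state and action sets, discount $\gamma\in(0,1)$, reward $\mathbf R:\mathcal S\times\mathcal A\to\mathbb R^d$ ($d\ge1$) and an initial state distribution. For a stationary stochastic policy $\pi$ let $\mathbf V^\pi=\mathbb E_\pi[\sum_{t\ge0}\gamma^t\mathbf R(s_t,a_t)]\in\mathbb R^d$; for a possible trajectory $\tau=(s_0,a_0,\dots,s_T,a_T)$ (positive initial and transition probabilities) let $\mathbf R(\tau)=\sum_{t\le T}\gamma^t\mathbf R(s_t,a_t)$. A vector $x$ is dominated by $y$ if $x\le y$ componentwise and $x\neq y$. The Pareto front $\mathcal P$ is the set of all $\mathbf V^\pi$ that are not dominated by any $\mathbf V^{\pi'}$. A query is a pair of policies or a pair of trajectories of horizon $T$; its difference $\Delta$ is the difference of the two vector returns. **Assumptions.** (B1) $\mathcal C=\{\lambda w:\lambda>0,\ w\in\mathcal W\}$, where $\mathcal W\subset\mathbb R_{\ge0}^d\setminus\{0\}$ is nonempty, compact, convex and of angular diameter at most $\alpha$. (B2) $\|\Delta\|_2\le B$ for every query,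 where $B>0$. (B3) A query answered with latent direction $w\in\mathcal W$ prefers its first item, with return $r$, over its second, with return $r'$, with probability $e^{\eta w^\top r}/(e^{\eta w^\top r}+e^{\eta w^\top r'})$, where $\eta>0$. (B4) Queries are drawn from a probability distribution $\nu$ on a finite collection, and the differences $\Delta$ of the queries of positive probability span $\mathbb R^d$. **Data.** There are latent directions $w^\star_1,\dots,w^\star_m\in\mathcal W$ that cover the cone up to angle $\theta$: every $u\in\mathcal W$ makes an angle at most $\theta$ with some nonzero vector of $\operatorname{cone}\{w^\star_1,\dots,w^\star_m\}$ (for instance they generate $\mathcal C$). The dataset $\mathcal D$ consists of $m$ independent subsets; the $k$-th consists of $N$ i.i.d. comparisons with query law $\nu$ and latent direction $w^\star_k$. **Algorithm 1.** Let $\hat w_k$ be any minimizer over $\mathcal W$ of the empirical logistic loss of the $k$-th subset, and $\hat{\mathcal C}=\operatorname{cone}\{\hat w_1,\dots,\hat w_m\}$. Start with $\hat{\mathcal P}=\emptyset$. In each of $K$ iterations, sample $w$ uniformly (normalized surface measure, independently given $\mathcal D$) from $\hat{\mathcal C}\cap S^{d-1}$, let $\pi$ be a deterministic policy that is greedy for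 the limit of value iteration with the scalar reward $w^\top\mathbf R$ (ties are broken arbitrarily), and add $\mathbf V^{\pi}$ to $\hat{\mathcal P}$ unless it is dominated by an element of $\hat{\mathcal P}$. Return $\hat{\mathcal P}$. **$\varepsilon$-approximation.** $\hat{\mathcal P}$ is an $\varepsilon$-approximate Pareto front (under the scalarizations in $\mathcal C$) if for every $V\in\mathcal P$ and every $u\in\mathcal C\cap S^{d-1}$ such that $u^\top V=\max_\pi u^\top\mathbf V^\pi$ there is $\hat V\in\hat{\mathcal P}$ with $|u^\top V-u^\top\hat V|\le\varepsilon$. **Proposition.** There are constants $C_1,c_0>0$ that depend only on $d$, $B$, $|\mathcal S|$ and $|\mathcal A|$ such that, under (B1)–(B4), the following holds for some $C_2>0$ that does not depend on $\varepsilon$, $\delta$, $m$, $w^\star_1,\dots,w^\star_m$. Let $\varepsilon\in(0,1]$ and $\delta\in(0,1)$. If the latent directions cover the cone up to angle $c_0\varepsilon$, and $$N\ \ge\ \frac{C_2\,(1+\ln(m/\delta))}{\varepsilon^{2}},\qquad K\ \ge\ \frac{C_1\,(1+\ln(1/\delta))}{\varepsilon^{d-1}},$$ then Algorithm 1 returns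 an $\varepsilon$-approximate Pareto front with probability at least $1-\delta$. In particular $K=O(\varepsilon^{-(d-1)}\ln(1/\delta))$ iterations suffice for $\delta\le 1/2$, and $K=O(\varepsilon^{-(d-1)})$ iterations suffice for fixed $\delta$. -/

import Mathlib

open MeasureTheory ProbabilityTheory Filter Topology

noncomputable section

namespace MOIRL

/-- The space `ℝ^d` of vector rewards and of scalarization directions, with the Euclidean norm. -/
abbrev Vec (d : ℕ) : Type := EuclideanSpace ℝ (Fin d)

/-! ### Multi-objective Markov decision processes -/

/-- A multi-objective MDP with finite state space `S`, finite action space `A`, `d` objectives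
and an initial state distribution `init`. -/
structure MOMDP (S A : Type*) [Fintype S] [Fintype A] (d : ℕ) where
  /-- `P s a s'` is the probability of moving to `s'` when action `a` is played in state `s`. -/
  P : S → A → S → ℝ
  P_mem : ∀ s a, P s a ∈ stdSimplex ℝ S
  γ : ℝ
  γ_pos : 0 < γ
  γ_lt_one : γ < 1
  /-- The vector-valued reward. -/
  R : S → A → Vec d
  /-- The law of the initial state. -/
  init : S → ℝ
  init_mem : init ∈ stdSimplex ℝ S

/-- A stationary stochastic policy `S → Δ(A)`. -/
structure Policy (S A : Type*) [Fintype A] where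
  prob : S → A → ℝ
  prob_mem : ∀ s, prob s ∈ stdSimplex ℝ A

section MDP

variable {S A : Type*} [Fintype S] [Fintype A] {d : ℕ}

open Classical in
/-- The deterministic policy that plays `f s` in state `s`. -/
def Policy.ofFun (f : S → A) : Policy S A where
  prob s a := if a = f s then 1 else 0
  prob_mem s := by
    refine ⟨fun a => ?_, by simp⟩
    show (0 : ℝ) ≤ if a = f s then 1 else 0
    split_ifs <;> norm_num

/-- The law of the state at time `t` when `π` is followed. -/
def stateLaw (M : MOMDP S A d) (π : Policy S A) : ℕ → S → ℝ
  | 0 => M.init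
  | t + 1 => fun s' => ∑ s, ∑ a, stateLaw M π t s * π.prob s a * M.P s a s'

/-- The expected discounted vector return `V^π = ∑ₜ γ^t E_π[R(sₜ, aₜ)]`. -/
def value (M : MOMDP S A d) (π : Policy S A) : Vec d :=
  ∑' t : ℕ, M.γ ^ t • ∑ s, ∑ a, (stateLaw M π t s * π.prob s a) • M.R s a

/-- A possible trajectory `(s₀, a₀), …, (s_T, a_T)` of the MDP. -/
structure Trajectory (M : MOMDP S A d) (T : ℕ) where
  state : Fin (T + 1) → S
  action : Fin (T + 1) → A
  init_pos : 0 < M.init (state 0)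
  step_pos : ∀ i : Fin T, 0 < M.P (state i.castSucc) (action i.castSucc) (state i.succ)

/-- The vector return `R(τ) = ∑_{t ≤ T} γ^t R(sₜ, aₜ)` of a trajectory. -/
def Trajectory.ret {M : MOMDP S A d} {T : ℕ} (τ : Trajectory M T) : Vec d :=
  ∑ t : Fin (T + 1), M.γ ^ (t : ℕ) • M.R (τ.state t) (τ.action t)

/-! ### Pareto fronts -/

/-- `x` is dominated by `y`. -/
def Dominated (x y : Vec d) : Prop := (∀ i, x i ≤ y i) ∧ x ≠ y

/-- The Pareto front: the returns of policies that no policy dominates. -/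
def paretoFront (M : MOMDP S A d) : Set (Vec d) :=
  {V | ∃ π, V = value M π ∧ ¬ ∃ π', Dominated V (value M π')}

/-- `Phat` is an `ε`-approximation of the Pareto front under the scalarizations in the cone `C`:
whenever a point `V` of the Pareto front is optimal for a unit direction `u ∈ C`, some point of
`Phat` has the same `u`-scalarized value up to `ε`. -/
def IsApproxParetoFront (M : MOMDP S A d) (C : Set (Vec d)) (ε : ℝ) (Phat : Set (Vec d)) : Prop :=
  ∀ V ∈ paretoFront M, ∀ u ∈ C, ‖u‖ = 1 → (∀ π, inner ℝ u (value M π) ≤ inner ℝ u V) →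
    ∃ V' ∈ Phat, |inner ℝ u V - inner ℝ u V'| ≤ ε

/-! ### Reward cones -/

/-- The conic extension `{λ w | λ > 0, w ∈ W}` of a set `W` of admissible preference directions. -/
def conicExtension (W : Set (Vec d)) : Set (Vec d) := {x | ∃ r : ℝ, 0 < r ∧ ∃ w ∈ W, x = r • w}

/-- The set `W` of admissible preference directions is nonempty, compact, convex, consists of
nonzero vectors with nonnegative entries, and has angular diameter at most `α`. -/
structure IsDirectionSet (W : Set (Vec d)) (α : ℝ) : Prop where
  nonempty : W.Nonempty
  isCompact : IsCompact W
  convex : Convex ℝ W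
  zero_notMem : (0 : Vec d) ∉ W
  nonneg : ∀ w ∈ W, ∀ i, 0 ≤ w i
  angle_le : ∀ w ∈ W, ∀ w' ∈ W, InnerProductGeometry.angle w w' ≤ α

/-- The convex cone generated by finitely many vectors. -/
def cone {m : ℕ} (w : Fin m → Vec d) : Set (Vec d) :=
  {x | ∃ c : Fin m → ℝ, (∀ k, 0 ≤ c k) ∧ x = ∑ k, c k • w k}

/-! ### Preference data and logistic regression -/

/-- A preference query: two policies, or two trajectories of horizon `T`, are compared. -/
inductive Query (M : MOMDP S A d) (T : ℕ)
  | policies (π π' : Policy S A) : Query M T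
  | trajectories (τ τ' : Trajectory M T) : Query M T

/-- The vector return of the first item of a query. -/
def Query.fstRet {M : MOMDP S A d} {T : ℕ} : Query M T → Vec d
  | .policies π _ => value M π
  | .trajectories τ _ => τ.ret

/-- The vector return of the second item of a query. -/
def Query.sndRet {M : MOMDP S A d} {T : ℕ} : Query M T → Vec d
  | .policies _ π' => value M π'
  | .trajectories _ τ' => τ'.ret

/-- The difference of the vector returns of the two items of a query. -/
def Query.diff {M : MOMDP S A d} {T : ℕ} (q : Query M T) : Vec d := q.fstRet - q.sndRet

/-- The Plackett–Luce (Bradley–Terry) probability, for the latent direction `w` and the inverse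
temperature `η`, that the first item of the query is preferred. -/
def prefProb (η : ℝ) {M : MOMDP S A d} {T : ℕ} (w : Vec d) (q : Query M T) : ℝ :=
  Real.exp (η * inner ℝ w q.fstRet) /
    (Real.exp (η * inner ℝ w q.fstRet) + Real.exp (η * inner ℝ w q.sndRet))

theorem prefProb_mem (η : ℝ) {M : MOMDP S A d} {T : ℕ} (w : Vec d) (q : Query M T) :
    prefProb η w q ∈ unitInterval := by
  unfold prefProb
  have h1 := Real.exp_pos (η * inner ℝ w q.fstRet)
  have h2 := Real.exp_pos (η * inner ℝ w q.sndRet)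
  exact ⟨by positivity, (div_le_one (by positivity)).2 (by linarith)⟩

/-- A labelled comparison: the index of the query that was asked, and the label (`true` when the
first item was preferred). -/
abbrev Comparison (J : ℕ) : Type := Fin J × Bool

/-- The law of one comparison: the query is drawn from `ν`, and the label follows the Plackett–Luce
model with latent direction `w`. -/
def comparisonLaw (η : ℝ) {M : MOMDP S A d} {T J : ℕ} (q : Fin J → Query M T) (ν : PMF (Fin J))
    (w : Vec d) : Measure (Comparison J) :=
  ∑ j, ν j • (Measure.dirac j).prod (bernoulliMeasure true false ⟨prefProb η w (q j),
    prefProb_mem η w (q j)⟩)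

/-- The law of a dataset that consists of `m` independent subsets, the `k`-th of which holds `N`
i.i.d. comparisons with latent direction `w k`. -/
def datasetLaw (η : ℝ) {M : MOMDP S A d} {T J m : ℕ} (q : Fin J → Query M T) (ν : PMF (Fin J))
    (N : ℕ) (w : Fin m → Vec d) : Measure (Fin m → Fin N → Comparison J) :=
  Measure.pi fun k => Measure.pi fun _ => comparisonLaw η q ν (w k)

/-- The empirical logistic (cross-entropy) loss of `w` on `N` comparisons. -/
def logisticLoss (η : ℝ) {M : MOMDP S A d} {T J N : ℕ} (q : Fin J → Query M T)
    (D : Fin N → Comparison J) (w : Vec d) : ℝ :=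
  (1 / (N : ℝ)) * ∑ i, -(if (D i).2 then Real.log (prefProb η w (q (D i).1))
    else Real.log (1 - prefProb η w (q (D i).1)))

/-- `w` is a logistic-regression estimate: a minimizer over `W` of the empirical logistic loss. -/
def IsLogisticEstimate (η : ℝ) {M : MOMDP S A d} {T J N : ℕ} (q : Fin J → Query M T)
    (W : Set (Vec d)) (D : Fin N → Comparison J) (w : Vec d) : Prop :=
  w ∈ W ∧ ∀ w' ∈ W, logisticLoss η q D w ≤ logisticLoss η q D w'

/-! ### Value iteration -/

/-- The state-action value of the state-value function `v` for the scalarized reward `wᵀR`. -/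
def qValue (M : MOMDP S A d) (w : Vec d) (v : S → ℝ) (s : S) (a : A) : ℝ :=
  inner ℝ w (M.R s a) + M.γ * ∑ s', M.P s a s' * v s'

/-- The Bellman optimality operator for the scalarized reward `wᵀR`. -/
def bellman [Nonempty A] (M : MOMDP S A d) (w : Vec d) (v : S → ℝ) : S → ℝ :=
  fun s => Finset.univ.sup' Finset.univ_nonempty (qValue M w v s)

/-- `f` is a result of value iteration for the scalarized reward `wᵀR`: it is greedy with respect
to the limit of the Bellman iterates. Ties may be broken in any way. -/
def IsValueIterationResult [Nonempty A] (M : MOMDP S A d) (w : Vec d) (f : S → A) : Prop :=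
  ∃ v : S → ℝ, Tendsto (fun n : ℕ => (bellman M w)^[n] 0) atTop (𝓝 v) ∧
    ∀ s a, qValue M w v s a ≤ qValue M w v s (f s)

/-! ### The recovery algorithm -/

/-- The uniform distribution on `C ∩ S^{d-1}`: normalized surface measure, i.e. Hausdorff measure
in the dimension of `C ∩ S^{d-1}`, which is one less than the dimension of the span of the convex
cone `C`. -/
def uniformDirection (C : Set (Vec d)) : Measure (Vec d) :=
  cond (Measure.hausdorffMeasure ((Module.finrank ℝ (Submodule.span ℝ C) : ℝ) - 1))
    (C ∩ Metric.sphere 0 1)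

open Classical in
/-- Add `V` to `Phat` unless it is dominated by an element of `Phat`. -/
def addIfNotDominated (Phat : Set (Vec d)) (V : Vec d) : Set (Vec d) :=
  if ∃ V' ∈ Phat, Dominated V V' then Phat else insert V Phat

/-- The main loop: starting from `∅`, for each direction `w k` in turn, the policy found for `w k`
is evaluated and its return is added unless it is dominated. -/
def recoveredFront (M : MOMDP S A d) (solve : Vec d → S → A) {K : ℕ} (w : Fin K → Vec d) :
    Set (Vec d) :=
  (List.ofFn w).foldl
    (fun Phat wk => addIfNotDominated Phat (value M (Policy.ofFun (solve wk)))) ∅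

/-- The probability that the algorithm, run for `K` iterations, fails to return an
`ε`-approximation of the Pareto front under the cone `C`. The dataset has law `dataLaw`; given the
dataset `D`, the directions are `K` independent uniform samples from the cone generated by the
estimates `est D`. -/
def failureProb (M : MOMDP S A d) (C : Set (Vec d)) (ε : ℝ) {J m N : ℕ}
    (dataLaw : Measure (Fin m → Fin N → Comparison J))
    (est : (Fin m → Fin N → Comparison J) → Fin m → Vec d)
    (solve : Vec d → S → A) (K : ℕ) : ENNReal :=
  ∫⁻ D, (Measure.pi fun _ : Fin K => uniformDirection (cone (est D)))
    {w | ¬ IsApproxParetoFront M C ε (recoveredFront M solve w)} ∂dataLaw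

end MDP

end MOIRL

end

/-! A direction `u` can be lost only if every sampled direction is far from `u`: when `x` is within
`ε / B` of `u`, a policy optimal for `x` is `ε`-optimal for `u`, because value differences have norm
at most `B`. Discarding dominated values is harmless, since directions in the cone are nonnegative.
It remains to show that the samples come near all relevant directions.

A net of directions would cost an extra factor `log (1 / ε)` in `K`. Instead, the failure event is
split according to the set `F` of deterministic policies that were found. There are finitely many
such sets, independently of `ε`, and for each of them one missed direction can be fixed before
sampling. All `K` samples must then avoid a ball of radius of order `ε` about a nearby direction of
the estimated cone (`pi_not_isApproxParetoFront_le`).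

Such a ball has probability at least a constant times `ε ^ (d - 1)`, however thin or low-dimensional
the cone is: contracting the cross-section towards a point of itself has a Lipschitz inverse, so the
small image keeps a definite share of the surface measure (`hausdorffMeasure_sphere_le`,
`le_uniformDirection_closedBall`).

The estimated cone is close to the true one because the expected logistic loss grows quadratically
around the latent direction, while the empirical fluctuation of the excess loss is linear in the
distance. The estimation error is thus of the order of the frequency deviations, which Hoeffding's
inequality bounds by order `ε` once `N` is of order `ε ^ (-2)`
(`exists_norm_logisticEstimate_sub_le`, `datasetLaw_deviation_le`). In the orthant generators cannot
cancel, so close generators span angularly close cones (`exists_mem_cone_norm_sub_le`). -/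

noncomputable section

namespace MOIRL

/-! ### Optimality of the policies found by value iteration -/

section PolicyValue

variable {S A : Type*} [Fintype S] [Fintype A] {d : ℕ}

/-- Averaging over the actions played by a policy and the successor states preserves mass. -/
theorem sum_stateLaw_succ (M : MOMDP S A d) (π : Policy S A) (t : ℕ) (v : S → ℝ) :
    ∑ s', stateLaw M π (t + 1) s' * v s' =
      ∑ s, stateLaw M π t s * ∑ a, π.prob s a * ∑ s', M.P s a s' * v s' := by
  simp only [stateLaw, Finset.sum_mul, Finset.mul_sum]
  rw [Finset.sum_comm]
  refine Finset.sum_congr rfl fun s _ => ?_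
  rw [Finset.sum_comm]
  refine Finset.sum_congr rfl fun a _ => Finset.sum_congr rfl fun s' _ => ?_
  ring

theorem stateLaw_mem (M : MOMDP S A d) (π : Policy S A) (t : ℕ) :
    stateLaw M π t ∈ stdSimplex ℝ S := by
  induction t with
  | zero => exact M.init_mem
  | succ t ih =>
    refine ⟨fun s' => ?_, ?_⟩
    · exact Finset.sum_nonneg fun s _ => Finset.sum_nonneg fun a _ =>
        mul_nonneg (mul_nonneg (ih.1 s) ((π.prob_mem s).1 a)) ((M.P_mem s a).1 s')
    · have h := sum_stateLaw_succ M π t 1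
      simpa [(M.P_mem _ _).2, (π.prob_mem _).2, ih.2] using h

/-- The expected reward at time `t`. -/
def rewardAt (M : MOMDP S A d) (π : Policy S A) (t : ℕ) : Vec d :=
  ∑ s, ∑ a, (stateLaw M π t s * π.prob s a) • M.R s a

theorem summable_rewardAt (M : MOMDP S A d) (π : Policy S A) :
    Summable fun t : ℕ => M.γ ^ t • rewardAt M π t := by
  refine Summable.of_norm_bounded (g := fun t => M.γ ^ t * ∑ s, ∑ a, ‖M.R s a‖)
    ((summable_geometric_of_lt_one M.γ_pos.le M.γ_lt_one).mul_right _) fun t => ?_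
  rw [norm_smul, Real.norm_of_nonneg (pow_nonneg M.γ_pos.le t)]
  refine mul_le_mul_of_nonneg_left ?_ (pow_nonneg M.γ_pos.le t)
  refine (norm_sum_le _ _).trans (Finset.sum_le_sum fun s _ => (norm_sum_le _ _).trans
    (Finset.sum_le_sum fun a _ => ?_))
  have h1 := mem_Icc_of_mem_stdSimplex (stateLaw_mem M π t) s
  have h2 := mem_Icc_of_mem_stdSimplex (π.prob_mem s) a
  rw [norm_smul, Real.norm_of_nonneg (mul_nonneg h1.1 h2.1)]
  exact mul_le_of_le_one_left (norm_nonneg _) (mul_le_one₀ h1.2 h2.1 h2.2)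

theorem hasSum_value (M : MOMDP S A d) (π : Policy S A) (w : Vec d) :
    HasSum (fun t : ℕ => M.γ ^ t * inner ℝ w (rewardAt M π t)) (inner ℝ w (value M π)) := by
  have h := (summable_rewardAt M π).hasSum.mapL (innerSL ℝ w)
  simp only [innerSL_apply_apply, inner_smul_right] at h
  exact h

/-- Averaging the state-action values over the actions and the law of the state at time `t`. -/
theorem sum_stateLaw_qValue (M : MOMDP S A d) (π : Policy S A) (w : Vec d) (v : S → ℝ) (t : ℕ) :
    ∑ s, stateLaw M π t s * ∑ a, π.prob s a * qValue M w v s a =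
      inner ℝ w (rewardAt M π t) + M.γ * ∑ s, stateLaw M π (t + 1) s * v s := by
  rw [sum_stateLaw_succ, rewardAt, inner_sum, Finset.mul_sum, ← Finset.sum_add_distrib]
  refine Finset.sum_congr rfl fun s _ => ?_
  rw [inner_sum]
  simp only [qValue, mul_add, Finset.sum_add_distrib, inner_smul_right]
  congr 1
  · rw [Finset.mul_sum]
    exact Finset.sum_congr rfl fun a _ => by ring
  · simp only [Finset.mul_sum]
    exact Finset.sum_congr rfl fun a _ => Finset.sum_congr rfl fun s' _ => by ring

/-- Telescoping along a policy: the scalarized value differs from the average of `v` by the discounted Bellman gaps. -/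
theorem hasSum_bellman_gap (M : MOMDP S A d) (π : Policy S A) (w : Vec d) (v : S → ℝ) :
    HasSum (fun t : ℕ => M.γ ^ t * ∑ s, stateLaw M π t s *
        (v s - ∑ a, π.prob s a * qValue M w v s a))
      (∑ s, M.init s * v s - inner ℝ w (value M π)) := by
  have h1 : HasSum (fun t : ℕ => M.γ ^ t * ∑ s, stateLaw M π t s * v s -
      M.γ ^ (t + 1) * ∑ s, stateLaw M π (t + 1) s * v s) (∑ s, M.init s * v s) := by
    have hs : Summable fun t : ℕ => M.γ ^ t * ∑ s, stateLaw M π t s * v s := by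
      refine Summable.of_norm_bounded (g := fun t : ℕ => M.γ ^ t * ∑ s, |v s|)
        ((summable_geometric_of_lt_one M.γ_pos.le M.γ_lt_one).mul_right _) fun n => ?_
      rw [norm_mul, Real.norm_of_nonneg (pow_nonneg M.γ_pos.le n)]
      refine mul_le_mul_of_nonneg_left ?_ (pow_nonneg M.γ_pos.le n)
      refine (norm_sum_le _ _).trans (Finset.sum_le_sum fun s _ => ?_)
      have h1 := mem_Icc_of_mem_stdSimplex (stateLaw_mem M π n) s
      rw [norm_mul, Real.norm_of_nonneg h1.1, Real.norm_eq_abs]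
      exact mul_le_of_le_one_left (abs_nonneg _) h1.2
    -- Subtracting the series shifted by one index leaves only the term at time zero.
    have h := hs.hasSum.sub ((hasSum_nat_add_iff' 1).2 hs.hasSum)
    simpa [stateLaw] using h
  refine (h1.sub (hasSum_value M π w)).congr_fun fun t => ?_
  have h := sum_stateLaw_qValue M π w v t
  simp only [mul_sub, Finset.sum_sub_distrib]
  rw [h]
  ring

/-- The limit of the Bellman iterates is a fixed point of the Bellman operator. -/
theorem bellman_eq_of_tendsto [Nonempty A] (M : MOMDP S A d) (w : Vec d) (v : S → ℝ)
    (hv : Tendsto (fun n : ℕ => (bellman M w)^[n] 0) atTop (𝓝 v)) : bellman M w v = v := by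
  have hc : Continuous (bellman M w) := by
    refine continuous_pi fun s => ?_
    have h := Continuous.finset_sup'_apply (s := Finset.univ) Finset.univ_nonempty
      (f := fun a v => qValue M w v s a) fun a _ => by unfold qValue; fun_prop
    exact h
  exact isFixedPt_of_tendsto_iterate hv hc.continuousAt

/-- A greedy policy for the limit of value iteration maximizes the scalarized value. -/
theorem IsValueIterationResult.inner_value_le [Nonempty A] {M : MOMDP S A d} {w : Vec d}
    {f : S → A} (hf : IsValueIterationResult M w f) (π : Policy S A) :
    inner ℝ w (value M π) ≤ inner ℝ w (value M (Policy.ofFun f)) := by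
  obtain ⟨v, hv, hgreedy⟩ := hf
  have hle : ∀ s a, qValue M w v s a ≤ v s := fun s a => by
    conv_rhs => rw [← bellman_eq_of_tendsto M w v hv]
    exact Finset.le_sup' (qValue M w v s) (Finset.mem_univ a)
  have heq : ∀ s, qValue M w v s (f s) = v s := fun s => by
    refine (hle s _).antisymm ?_
    conv_lhs => rw [← bellman_eq_of_tendsto M w v hv]
    exact Finset.sup'_le _ _ fun a _ => hgreedy s a
  have h0 : 0 ≤ ∑ s, M.init s * v s - inner ℝ w (value M π) := by
    refine (hasSum_bellman_gap M π w v).nonneg fun t => mul_nonneg (pow_nonneg M.γ_pos.le t) ?_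
    refine Finset.sum_nonneg fun s _ => mul_nonneg ((stateLaw_mem M π t).1 s) (sub_nonneg.2 ?_)
    calc ∑ a, π.prob s a * qValue M w v s a ≤ ∑ a, π.prob s a * v s :=
          Finset.sum_le_sum fun a _ => mul_le_mul_of_nonneg_left (hle s a) ((π.prob_mem s).1 a)
      _ = v s := by rw [← Finset.sum_mul, (π.prob_mem s).2, one_mul]
  -- Along the greedy policy every Bellman gap vanishes, so its value equals the upper bound `h0`.
  have h1 : ∑ s, M.init s * v s - inner ℝ w (value M (Policy.ofFun f)) = 0 := by
    refine (hasSum_bellman_gap M (Policy.ofFun f) w v).unique ?_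
    have hf : ∀ s, ∑ a, (Policy.ofFun f).prob s a * qValue M w v s a = v s := fun s => by
      rw [Finset.sum_eq_single (f s) (fun a _ ha => by simp [Policy.ofFun, ha]) (by simp), heq]
      simp [Policy.ofFun]
    simp [hf, hasSum_zero]
  linarith

end PolicyValue

/-! ### Reduction of failure to a missed direction -/

section RecoveredFront

variable {S A : Type*} [Fintype S] [Fintype A] {d : ℕ}

theorem subset_addIfNotDominated (F : Set (Vec d)) (V : Vec d) : F ⊆ addIfNotDominated F V := by
  unfold addIfNotDominated
  split_ifs
  exacts [subset_rfl, Set.subset_insert _ _]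

theorem exists_le_mem_addIfNotDominated (F : Set (Vec d)) (V : Vec d) :
    ∃ V' ∈ addIfNotDominated F V, ∀ i, V i ≤ V' i := by
  unfold addIfNotDominated
  split_ifs with h
  · obtain ⟨V', hV', h⟩ := h
    exact ⟨V', hV', h.1⟩
  · exact ⟨V, Set.mem_insert _ _, fun _ => le_rfl⟩

/-- Points are never removed, and a value is rejected only in favour of a retained point above it;
both properties survive all later iterations. -/
theorem foldl_addIfNotDominated {ι : Type*} (val : ι → Vec d) (l : List ι) (F : Set (Vec d)) :
    F ⊆ l.foldl (fun F x => addIfNotDominated F (val x)) F ∧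
    (∀ V ∈ l.foldl (fun F x => addIfNotDominated F (val x)) F, V ∈ F ∨ V ∈ Set.range val) ∧
    ∀ x ∈ l, ∃ V ∈ l.foldl (fun F x => addIfNotDominated F (val x)) F, ∀ i, val x i ≤ V i := by
  induction l generalizing F with
  | nil => exact ⟨subset_rfl, fun V hV => .inl hV, by simp⟩
  | cons y l ih =>
    obtain ⟨h1, h2, h3⟩ := ih (addIfNotDominated F (val y))
    refine ⟨(subset_addIfNotDominated _ _).trans h1, fun V hV => ?_, fun x hx => ?_⟩
    · rcases h2 V hV with h | h
      · unfold addIfNotDominated at h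
        split_ifs at h
        · exact .inl h
        · rcases h with rfl | h
          · exact .inr ⟨y, rfl⟩
          · exact .inl h
      · exact .inr h
    · rcases List.mem_cons.1 hx with rfl | hx
      · obtain ⟨V, hV, h⟩ := exists_le_mem_addIfNotDominated F (val x)
        exact ⟨V, h1 hV, h⟩
      · exact h3 x hx

/-- Every point of the recovered front is the value of some policy. -/
theorem exists_eq_value_of_mem_recoveredFront {M : MOMDP S A d} {solve : Vec d → S → A} {K : ℕ}
    {w : Fin K → Vec d} {V : Vec d} (hV : V ∈ recoveredFront M solve w) :
    ∃ π, V = value M π := by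
  rcases (foldl_addIfNotDominated (fun x => value M (Policy.ofFun (solve x))) (List.ofFn w) ∅).2.1
    V hV with h | ⟨x, rfl⟩
  exacts [h.elim, ⟨_, rfl⟩]

/-- The value found in each iteration is bounded above by a point of the recovered front. -/
theorem exists_le_mem_recoveredFront (M : MOMDP S A d) (solve : Vec d → S → A) {K : ℕ}
    (w : Fin K → Vec d) (k : Fin K) :
    ∃ V ∈ recoveredFront M solve w, ∀ i, value M (Policy.ofFun (solve (w k))) i ≤ V i :=
  (foldl_addIfNotDominated (fun x => value M (Policy.ofFun (solve x))) (List.ofFn w) ∅).2.2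
    (w k) (by simp)

theorem inner_le_inner_of_nonneg {u x y : Vec d} (hu : ∀ i, 0 ≤ u i) (h : ∀ i, x i ≤ y i) :
    inner ℝ u x ≤ inner ℝ u y := by
  simp only [PiLp.inner_apply]
  exact Finset.sum_le_sum fun i _ => by
    simpa [mul_comm] using mul_le_mul_of_nonneg_left (h i) (hu i)

/-- A unit direction `u` and an optimal value `V` for `u` that none of the policies in `F`
attains up to `ε`. -/
def IsMissedDirection (M : MOMDP S A d) (C : Set (Vec d)) (ε : ℝ) (F : Set (S → A))
    (u : Vec d) : Prop :=
  u ∈ C ∧ ‖u‖ = 1 ∧ ∃ V, (∃ π, V = value M π) ∧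
    ∀ f ∈ F, inner ℝ u (value M (Policy.ofFun f)) < inner ℝ u V - ε

/-- When the recovered front is not an approximation, the set of policies that were found misses a
direction. -/
theorem exists_isMissedDirection {M : MOMDP S A d} {C : Set (Vec d)} (hC : ∀ u ∈ C, ∀ i, 0 ≤ u i)
    {ε : ℝ} {solve : Vec d → S → A} {K : ℕ} {w : Fin K → Vec d}
    (h : ¬ IsApproxParetoFront M C ε (recoveredFront M solve w)) :
    ∃ u, IsMissedDirection M C ε (Set.range fun k => solve (w k)) u := by
  simp only [IsApproxParetoFront] at h
  push Not at h
  obtain ⟨V, ⟨π, hπ, -⟩, u, hu, hu1, hopt, hV⟩ := h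
  refine ⟨u, hu, hu1, V, ⟨π, hπ⟩, ?_⟩
  rintro _ ⟨k, rfl⟩
  obtain ⟨V', hV', hle⟩ := exists_le_mem_recoveredFront M solve w k
  obtain ⟨π', rfl⟩ := exists_eq_value_of_mem_recoveredFront hV'
  have h1 := hV _ hV'
  rw [abs_of_nonneg (sub_nonneg.2 (hopt π'))] at h1
  have h2 := inner_le_inner_of_nonneg (hC u hu) hle
  dsimp only
  linarith

/-- A policy that is optimal for a direction near `u` nearly attains the optimum for `u`, so the
directions whose policies were found are far from a missed direction. -/
theorem IsMissedDirection.lt_norm_sub [Nonempty A] {M : MOMDP S A d} {C : Set (Vec d)} {ε B : ℝ}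
    (hB : 0 < B) (hdiff : ∀ π π' : Policy S A, ‖value M π - value M π'‖ ≤ B) {F : Set (S → A)}
    {u : Vec d} (hu : IsMissedDirection M C ε F u) {x : Vec d} {f : S → A} (hf : f ∈ F)
    (hx : IsValueIterationResult M x f) : ε / B < ‖x - u‖ := by
  obtain ⟨-, -, V, ⟨π, rfl⟩, h⟩ := hu
  have h1 := h f hf
  have h2 := hx.inner_value_le π
  -- Optimality for `x` makes the `x`-part of this inner product nonpositive, so the left side is at
  -- least the loss for `u`, which exceeds `ε`.
  have h3 : inner ℝ (u - x) (value M π - value M (Policy.ofFun f)) ≤ ‖x - u‖ * B :=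
    (real_inner_le_norm _ _).trans (by
      rw [norm_sub_rev]
      exact mul_le_mul_of_nonneg_left (hdiff _ _) (norm_nonneg _))
  simp only [inner_sub_left, inner_sub_right] at h3
  rw [div_lt_iff₀ hB]
  linarith

end RecoveredFront

/-! ### Surface measure of small balls in a spherical cone -/

section SphericalCone

variable {d : ℕ}

/-- The sum of the coordinates, which is the `ℓ¹` norm on the nonnegative orthant. -/
def coordSum (x : Vec d) : ℝ := ∑ i, x i

theorem coordSum_add (x y : Vec d) : coordSum (x + y) = coordSum x + coordSum y := by
  simp [coordSum, Finset.sum_add_distrib]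

theorem coordSum_smul (a : ℝ) (x : Vec d) : coordSum (a • x) = a * coordSum x := by
  simp [coordSum, Finset.mul_sum]

theorem abs_coordSum_le (x : Vec d) : |coordSum x| ≤ d * ‖x‖ := by
  refine (Finset.abs_sum_le_sum_abs _ _).trans ?_
  refine (Finset.sum_le_sum fun i _ => PiLp.norm_apply_le x i).trans ?_
  simp

theorem abs_coordSum_sub_le (x y : Vec d) : |coordSum x - coordSum y| ≤ d * ‖x - y‖ := by
  have h := abs_coordSum_le (x - y)
  simpa [coordSum] using h

theorem norm_le_coordSum {x : Vec d} (hx : ∀ i, 0 ≤ x i) : ‖x‖ ≤ coordSum x := by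
  have h0 : 0 ≤ coordSum x := Finset.sum_nonneg fun i _ => hx i
  refine abs_le_of_sq_le_sq' ?_ h0 |>.2
  rw [EuclideanSpace.norm_sq_eq, coordSum]
  simpa using Finset.sum_sq_le_sq_sum_of_nonneg (s := Finset.univ) fun i _ => hx i

/-- Rescaling by a Lipschitz gauge bounded below is Lipschitz on bounded sets. -/
theorem norm_inv_smul_sub_le {g : Vec d → ℝ} {c K : ℝ} (hc : 0 < c) {x y : Vec d} (hx : c ≤ g x)
    (hy : c ≤ g y) (hg : |g x - g y| ≤ K * ‖x - y‖) (hy1 : ‖y‖ ≤ 1) :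
    ‖(g x)⁻¹ • x - (g y)⁻¹ • y‖ ≤ (c⁻¹ + K * c⁻¹ ^ 2) * ‖x - y‖ := by
  have hgx : 0 < g x := hc.trans_le hx
  have hgy : 0 < g y := hc.trans_le hy
  have h1 : (g x)⁻¹ • x - (g y)⁻¹ • y
      = (g x)⁻¹ • (x - y) + ((g x)⁻¹ * (g y)⁻¹ * (g y - g x)) • y := by
    rw [smul_sub, sub_add, ← sub_smul]
    congr 2
    field_simp
    ring
  have hxi : (g x)⁻¹ ≤ c⁻¹ := inv_anti₀ hc hx
  have hyi : (g y)⁻¹ ≤ c⁻¹ := inv_anti₀ hc hy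
  rw [h1, add_mul]
  refine (norm_add_le _ _).trans (add_le_add ?_ ?_)
  · rw [norm_smul, Real.norm_of_nonneg (inv_nonneg.2 hgx.le)]
    exact mul_le_mul_of_nonneg_right hxi (norm_nonneg _)
  · rw [norm_smul, norm_mul, Real.norm_of_nonneg (by positivity), Real.norm_eq_abs, abs_sub_comm]
    calc (g x)⁻¹ * (g y)⁻¹ * |g x - g y| * ‖y‖ ≤ c⁻¹ * c⁻¹ * (K * ‖x - y‖) * 1 := by
          have := (abs_nonneg _).trans hg
          gcongr
      _ = K * c⁻¹ ^ 2 * ‖x - y‖ := by ring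

/-- The radial projection of the orthant to the simplex. -/
def toSlice (x : Vec d) : Vec d := (coordSum x)⁻¹ • x

/-- The radial projection to the sphere. -/
def toSphere (x : Vec d) : Vec d := ‖x‖⁻¹ • x

theorem coordSum_toSlice {x : Vec d} (hx : 0 < coordSum x) : coordSum (toSlice x) = 1 := by
  rw [toSlice, coordSum_smul, inv_mul_cancel₀ hx.ne']

theorem toSlice_smul {a : ℝ} (ha : 0 < a) (x : Vec d) : toSlice (a • x) = toSlice x := by
  rw [toSlice, toSlice, coordSum_smul, smul_smul, mul_inv, mul_right_comm, inv_mul_cancel₀ ha.ne',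
    one_mul]

theorem toSphere_smul {a : ℝ} (ha : 0 < a) (x : Vec d) : toSphere (a • x) = toSphere x := by
  rw [toSphere, toSphere, norm_smul, Real.norm_of_nonneg ha.le, smul_smul, mul_inv,
    mul_right_comm, inv_mul_cancel₀ ha.ne', one_mul]

theorem toSphere_of_norm_eq_one {x : Vec d} (hx : ‖x‖ = 1) : toSphere x = x := by
  simp [toSphere, hx]

theorem toSlice_of_coordSum_eq_one {x : Vec d} (hx : coordSum x = 1) : toSlice x = x := by
  simp [toSlice, hx]

/-- On unit vectors of the orthant the gauge `coordSum` is at least `1` and `d`-Lipschitz. -/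
theorem norm_toSlice_sub_le {x y : Vec d} (hx : ∀ i, 0 ≤ x i) (hx1 : ‖x‖ = 1) (hy : ∀ i, 0 ≤ y i)
    (hy1 : ‖y‖ = 1) : ‖toSlice x - toSlice y‖ ≤ (d + 1) * ‖x - y‖ := by
  refine (norm_inv_smul_sub_le one_pos (hx1 ▸ norm_le_coordSum hx) (hy1 ▸ norm_le_coordSum hy)
    (abs_coordSum_sub_le x y) hy1.le).trans_eq ?_
  ring

/-- On the slice the gauge is the norm, which is at least `1 / d` and `1`-Lipschitz; this gives `d +
d ^ 2`. -/
theorem norm_toSphere_sub_le (hd : 1 ≤ d) {x y : Vec d} (hx1 : coordSum x = 1)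
    (hy : ∀ i, 0 ≤ y i) (hy1 : coordSum y = 1) :
    ‖toSphere x - toSphere y‖ ≤ (d * (d + 1)) * ‖x - y‖ := by
  have hd0 : (0 : ℝ) < d := by exact_mod_cast hd
  have key : ∀ z : Vec d, coordSum z = 1 → (d : ℝ)⁻¹ ≤ ‖z‖ := fun z hz => by
    have := abs_coordSum_le z
    rw [hz, abs_one] at this
    rwa [inv_le_iff_one_le_mul₀' hd0]
  refine (norm_inv_smul_sub_le (g := fun z => ‖z‖) (K := 1) (inv_pos.2 hd0) (key x hx1) (key y hy1)
    (by simpa using abs_norm_sub_norm_le x y) (hy1 ▸ norm_le_coordSum hy)).trans_eq ?_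
  rw [inv_inv]
  ring

/-- In a convex cone inside the orthant, the surface measure of the spherical cross-section is
controlled by that of its part near one of its points: contracting the cross-section towards the
point is inverse to a Lipschitz map. -/
theorem hausdorffMeasure_sphere_le (hd : 1 ≤ d) {C : Set (Vec d)} (hC : ∀ x ∈ C, ∀ i, 0 ≤ x i)
    (hadd : ∀ x ∈ C, ∀ y ∈ C, x + y ∈ C) (hsmul : ∀ a : ℝ, 0 ≤ a → ∀ x ∈ C, a • x ∈ C)
    {x₀ : Vec d} (hx₀ : x₀ ∈ C) (hx₀1 : ‖x₀‖ = 1) {t : ℝ} (ht : 0 < t) (ht1 : t ≤ 1) {s : ℝ}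
    (hs : 0 ≤ s) :
    μH[s] (C ∩ Metric.sphere 0 1) ≤ ENNReal.ofReal (d * (d + 1) ^ 2 / t) ^ s *
      μH[s] ((C ∩ Metric.sphere 0 1) ∩ Metric.closedBall x₀ (2 * d * (d + 1) * t)) := by
  set X := C ∩ Metric.sphere (0 : Vec d) 1 with hX
  have hX1 : ∀ x ∈ X, ‖x‖ = 1 := fun x hx => by simpa using hx.2
  have hpos : ∀ x ∈ X, 0 < coordSum x := fun x hx =>
    one_pos.trans_le (hX1 x hx ▸ norm_le_coordSum (hC x hx.1))
  have hx₀X : x₀ ∈ X := ⟨hx₀, by simpa using hx₀1⟩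
  have hslice : ∀ x ∈ X, toSlice x ∈ C := fun x hx =>
    hsmul _ (inv_nonneg.2 (hpos x hx).le) x hx.1
  have hslice1 : ∀ x ∈ X, ‖toSlice x‖ ≤ 1 := fun x hx =>
    (norm_le_coordSum (hC _ (hslice x hx))).trans_eq (coordSum_toSlice (hpos x hx))
  have hback : ∀ x ∈ X, toSphere (toSlice x) = x := fun x hx => by
    rw [toSlice, toSphere_smul (inv_pos.2 (hpos x hx)), toSphere_of_norm_eq_one (hX1 x hx)]
  -- On the flat slice the contraction is a homothety of ratio `t`, which preserves the cone by
  -- convexity and scales distances exactly.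
  set ψ : Vec d → Vec d := fun x => (1 - t) • toSlice x₀ + t • toSlice x with hψ
  have hψC : ∀ x ∈ X, ψ x ∈ C := fun x hx =>
    hadd _ (hsmul _ (by linarith) _ (hslice _ hx₀X)) _ (hsmul _ ht.le _ (hslice x hx))
  have hψ1 : ∀ x ∈ X, coordSum (ψ x) = 1 := fun x hx => by
    rw [hψ, coordSum_add, coordSum_smul, coordSum_smul, coordSum_toSlice (hpos x hx),
      coordSum_toSlice (hpos _ hx₀X)]
    ring
  have hψn : ∀ x ∈ X, 0 < ‖ψ x‖ := fun x hx => norm_pos_iff.2 fun h => by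
    have := hψ1 x hx
    simp [h, coordSum] at this
  set φ : Vec d → Vec d := fun x => toSphere (ψ x) with hφ
  have hφX : ∀ x ∈ X, φ x ∈ X := fun x hx => by
    refine ⟨hsmul _ (inv_nonneg.2 (norm_nonneg _)) _ (hψC x hx), ?_⟩
    simp [hφ, toSphere, norm_smul, (hψn x hx).ne']
  have hφs : ∀ x ∈ X, toSlice (φ x) = ψ x := fun x hx => by
    change toSlice (‖ψ x‖⁻¹ • ψ x) = ψ x
    rw [toSlice_smul (inv_pos.2 (hψn x hx)), toSlice_of_coordSum_eq_one (hψ1 x hx)]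
  have hd0 : (0 : ℝ) < d := by exact_mod_cast hd
  -- The inverse costs `d * (d + 1)` from slice to sphere, `1 / t` for the homothety and `d + 1`
  -- from sphere to slice.
  have hanti : ∀ x ∈ X, ∀ y ∈ X, ‖x - y‖ ≤ d * (d + 1) ^ 2 / t * ‖φ x - φ y‖ := by
    intro x hx y hy
    have h1 := norm_toSphere_sub_le hd (coordSum_toSlice (hpos x hx)) (hC _ (hslice y hy))
      (coordSum_toSlice (hpos y hy))
    rw [hback x hx, hback y hy] at h1
    have h2 := norm_toSlice_sub_le (hC _ (hφX x hx).1) (hX1 _ (hφX x hx)) (hC _ (hφX y hy).1)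
      (hX1 _ (hφX y hy))
    rw [hφs x hx, hφs y hy] at h2
    have h3 : ‖ψ x - ψ y‖ = t * ‖toSlice x - toSlice y‖ := by
      rw [hψ, add_sub_add_left_eq_sub, ← smul_sub, norm_smul, Real.norm_of_nonneg ht.le]
    rw [h3] at h2
    calc ‖x - y‖ ≤ d * (d + 1) * ‖toSlice x - toSlice y‖ := h1
      _ = d * (d + 1) / t * (t * ‖toSlice x - toSlice y‖) := by field_simp
      _ ≤ d * (d + 1) / t * ((d + 1) * ‖φ x - φ y‖) := by gcongr
      _ = d * (d + 1) ^ 2 / t * ‖φ x - φ y‖ := by ring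
  -- The slice has diameter at most `2`; the homothety multiplies it by `t` and the return to the
  -- sphere by `d * (d + 1)`.
  have hball : ∀ x ∈ X, φ x ∈ Metric.closedBall x₀ (2 * d * (d + 1) * t) := by
    intro x hx
    rw [mem_closedBall_iff_norm]
    have h1 := norm_toSphere_sub_le hd (hψ1 x hx) (hC _ (hslice _ hx₀X))
      (coordSum_toSlice (hpos _ hx₀X))
    rw [hback _ hx₀X] at h1
    have h2 : ψ x - toSlice x₀ = t • (toSlice x - toSlice x₀) := by
      rw [hψ]; module
    rw [h2, norm_smul, Real.norm_of_nonneg ht.le] at h1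
    have h3 := (norm_sub_le (toSlice x) (toSlice x₀)).trans
      (add_le_add (hslice1 x hx) (hslice1 _ hx₀X))
    calc ‖φ x - x₀‖ ≤ d * (d + 1) * (t * ‖toSlice x - toSlice x₀‖) := h1
      _ ≤ d * (d + 1) * (t * (1 + 1)) := by gcongr
      _ = 2 * d * (d + 1) * t := by ring
  have hinj : Set.InjOn φ X := fun x hx y hy hxy => by
    have := hanti x hx y hy
    rw [hxy, sub_self, norm_zero, mul_zero] at this
    exact sub_eq_zero.1 (norm_le_zero_iff.1 this)
  have hlip : LipschitzOnWith (d * (d + 1) ^ 2 / t).toNNReal (Function.invFunOn φ X) (φ '' X) := by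
    refine LipschitzOnWith.of_dist_le_mul ?_
    rintro _ ⟨x, hx, rfl⟩ _ ⟨y, hy, rfl⟩
    rw [hinj.leftInvOn_invFunOn hx, hinj.leftInvOn_invFunOn hy, dist_eq_norm, dist_eq_norm,
      Real.coe_toNNReal _ (by positivity)]
    exact hanti x hx y hy
  have himg : Function.invFunOn φ X '' (φ '' X) = X := hinj.leftInvOn_invFunOn.image_image
  calc μH[s] X = μH[s] (Function.invFunOn φ X '' (φ '' X)) := by rw [himg]
    _ ≤ _ := hlip.hausdorffMeasure_image_le hs
    _ ≤ _ := by
      refine mul_le_mul' le_rfl (measure_mono ?_)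
      rintro _ ⟨x, hx, rfl⟩
      exact ⟨hφX x hx, hball x hx⟩

/-- A ball around a direction of the cone has at least the probability that scaling suggests. -/
theorem le_uniformDirection_closedBall (hd : 1 ≤ d) {C : Set (Vec d)}
    (hC : ∀ x ∈ C, ∀ i, 0 ≤ x i) (hadd : ∀ x ∈ C, ∀ y ∈ C, x + y ∈ C)
    (hsmul : ∀ a : ℝ, 0 ≤ a → ∀ x ∈ C, a • x ∈ C) {x₀ : Vec d} (hx₀ : x₀ ∈ C)
    (hx₀1 : ‖x₀‖ = 1) {ρ : ℝ} (hρ : 0 < ρ) (hρ1 : ρ ≤ 1) (hne : uniformDirection C ≠ 0) :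
    ENNReal.ofReal ((ρ / (2 * d ^ 2 * (d + 1) ^ 3)) ^ (d - 1)) ≤
      uniformDirection C (Metric.closedBall x₀ ρ) := by
  have hd1 : (1 : ℝ) ≤ d := by exact_mod_cast hd
  set k := Module.finrank ℝ (Submodule.span ℝ C) with hk
  have hk1 : 1 ≤ k := by
    rw [hk, Nat.one_le_iff_ne_zero, ← Nat.pos_iff_ne_zero, Module.finrank_pos_iff]
    refine ⟨⟨x₀, Submodule.subset_span hx₀⟩, 0, fun h => ?_⟩
    have : x₀ = 0 := congrArg Subtype.val h
    simp [this] at hx₀1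
  have hkd : k ≤ d := by simpa using Submodule.finrank_le (Submodule.span ℝ C)
  have hk0 : (0 : ℝ) ≤ (k : ℝ) - 1 := by
    have : (1 : ℝ) ≤ k := by exact_mod_cast hk1
    linarith
  -- The ratio for which the contracted cross-section fits in the ball of radius `ρ`; the Lipschitz
  -- constant of the inverse is then `κ⁻¹`.
  set t := ρ / (2 * d * (d + 1)) with ht
  have ht0 : 0 < t := by positivity
  have hD : (1 : ℝ) ≤ 2 * d * (d + 1) := by nlinarith
  have ht1 : t ≤ 1 := (div_le_one (by positivity)).2 (hρ1.trans hD)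
  have hmain := hausdorffMeasure_sphere_le hd hC hadd hsmul hx₀ hx₀1 ht0 ht1 hk0
  have hr : 2 * d * (d + 1) * t = ρ := by rw [ht]; field_simp
  set κ := ρ / (2 * d ^ 2 * (d + 1) ^ 3) with hκ
  have hκ0 : 0 < κ := by positivity
  have hκ1 : κ ≤ 1 := by
    refine (div_le_one (by positivity)).2 (hρ1.trans ?_)
    have h1 : (1 : ℝ) ≤ (d : ℝ) ^ 2 := one_le_pow₀ hd1
    have h2 : (1 : ℝ) ≤ ((d : ℝ) + 1) ^ 3 := one_le_pow₀ (by linarith)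
    nlinarith
  have hL : d * (d + 1) ^ 2 / t = κ⁻¹ := by rw [ht, hκ]; field_simp
  rw [hr, hL] at hmain
  have hne' := hne
  unfold uniformDirection at hne' ⊢
  -- Conditioning gives the zero measure exactly when the cross-section has measure `0` or `∞`.
  rw [Ne, cond_eq_zero, not_or] at hne'
  obtain ⟨hfin, hpos⟩ := hne'
  set μ : Measure (Vec d) := μH[(k : ℝ) - 1]
  set X := C ∩ Metric.sphere (0 : Vec d) 1
  have h1 : ProbabilityTheory.cond μ X (Metric.closedBall x₀ ρ)
      = (μ X)⁻¹ * μ (X ∩ Metric.closedBall x₀ ρ) := by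
    rw [ProbabilityTheory.cond, Measure.smul_apply, smul_eq_mul,
      Measure.restrict_apply Metric.isClosed_closedBall.measurableSet, Set.inter_comm]
  change _ ≤ ProbabilityTheory.cond μ X (Metric.closedBall x₀ ρ)
  rw [h1]
  have hkn : ((k : ℝ) - 1) = ((k - 1 : ℕ) : ℝ) := by push_cast [Nat.cast_sub hk1]; rfl
  rw [hkn, ENNReal.rpow_natCast, ← ENNReal.ofReal_pow (by positivity), inv_pow] at hmain
  have hp : 0 < κ ^ (k - 1) := by positivity
  -- The cone may span only a `k`-dimensional subspace; since `κ ≤ 1`, the exponent `d - 1` is the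
  -- worst case.
  calc ENNReal.ofReal (κ ^ (d - 1)) ≤ ENNReal.ofReal (κ ^ (k - 1)) :=
        ENNReal.ofReal_le_ofReal (pow_le_pow_of_le_one hκ0.le hκ1 (by omega))
    _ = (μ X)⁻¹ * (ENNReal.ofReal (κ ^ (k - 1)) * μ X) := by
        rw [mul_left_comm, ENNReal.inv_mul_cancel hpos hfin, mul_one]
    _ ≤ (μ X)⁻¹ * (ENNReal.ofReal (κ ^ (k - 1)) *
          (ENNReal.ofReal (κ ^ (k - 1))⁻¹ * μ (X ∩ Metric.closedBall x₀ ρ))) := by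
        gcongr
    _ = _ := by
        rw [← mul_assoc (ENNReal.ofReal _), ← ENNReal.ofReal_mul hp.le, mul_inv_cancel₀ hp.ne',
          ENNReal.ofReal_one, one_mul]

/-- The probability that `K` independent samples all miss a set. -/
theorem pi_forall_notMem_le {μ : Measure (Vec d)} [IsProbabilityMeasure μ] {s : Set (Vec d)}
    (hs : MeasurableSet s) {p : ℝ} (hp : 0 ≤ p) (h : ENNReal.ofReal p ≤ μ s) (K : ℕ) :
    (Measure.pi fun _ : Fin K => μ) {w | ∀ k, w k ∉ s} ≤ ENNReal.ofReal (Real.exp (-(p * K))) := by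
  have h1 : {w : Fin K → Vec d | ∀ k, w k ∉ s} = Set.univ.pi fun _ => sᶜ := by
    ext w; simp
  have h2 : μ sᶜ ≤ ENNReal.ofReal (Real.exp (-p)) := by
    rw [prob_compl_eq_one_sub hs]
    calc 1 - μ s ≤ 1 - ENNReal.ofReal p := tsub_le_tsub_left h 1
      _ = ENNReal.ofReal (1 - p) := by rw [ENNReal.ofReal_sub _ hp, ENNReal.ofReal_one]
      _ ≤ _ := ENNReal.ofReal_le_ofReal (Real.one_sub_le_exp_neg p)
  rw [h1, Measure.pi_pi]
  calc ∏ _k : Fin K, μ sᶜ ≤ ∏ _k : Fin K, ENNReal.ofReal (Real.exp (-p)) :=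
        Finset.prod_le_prod' fun _ _ => h2
    _ = _ := by
        rw [Finset.prod_const, Finset.card_univ, Fintype.card_fin,
          ← ENNReal.ofReal_pow (Real.exp_pos _).le, ← Real.exp_nat_mul]
        congr 2
        ring

end SphericalCone

/-! ### Perturbation of the generators of a cone -/

section Cone

variable {d m : ℕ}

theorem cone_nonneg {w : Fin m → Vec d} (hw : ∀ k i, 0 ≤ w k i) :
    ∀ x ∈ cone w, ∀ i, 0 ≤ x i := by
  rintro _ ⟨c, hc, rfl⟩ i
  simpa using Finset.sum_nonneg fun k _ => mul_nonneg (hc k) (hw k i)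

theorem cone_add {w : Fin m → Vec d} : ∀ x ∈ cone w, ∀ y ∈ cone w, x + y ∈ cone w := by
  rintro _ ⟨c, hc, rfl⟩ _ ⟨c', hc', rfl⟩
  exact ⟨c + c', fun k => add_nonneg (hc k) (hc' k), by
    simp [add_smul, Finset.sum_add_distrib]⟩

theorem cone_smul {w : Fin m → Vec d} : ∀ a : ℝ, 0 ≤ a → ∀ x ∈ cone w, a • x ∈ cone w := by
  rintro a ha _ ⟨c, hc, rfl⟩
  exact ⟨a • c, fun k => mul_nonneg ha (hc k), by simp [Finset.smul_sum, smul_smul]⟩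

/-- The chord is at most the arc: its square is `2 - 2 * cos`, and `1 - x ^ 2 / 2 ≤ cos x`. -/
theorem norm_toSphere_sub_toSphere_le_angle {x y : Vec d} (hx : x ≠ 0) (hy : y ≠ 0) :
    ‖toSphere x - toSphere y‖ ≤ InnerProductGeometry.angle x y := by
  have hx' := norm_pos_iff.2 hx
  have hy' := norm_pos_iff.2 hy
  refine abs_le_of_sq_le_sq' ?_ (InnerProductGeometry.angle_nonneg _ _) |>.2
  have h1 : ‖toSphere x‖ = 1 := by simp [toSphere, norm_smul, hx]
  have h2 : ‖toSphere y‖ = 1 := by simp [toSphere, norm_smul, hy]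
  have h3 : inner ℝ (toSphere x) (toSphere y) = Real.cos (InnerProductGeometry.angle x y) := by
    rw [InnerProductGeometry.cos_angle, toSphere, toSphere, real_inner_smul_left,
      real_inner_smul_right]
    field_simp
  rw [norm_sub_sq_real, h1, h2, h3]
  have := Real.one_sub_sq_div_two_le_cos (x := InnerProductGeometry.angle x y)
  linarith

/-- Replacing the generators of a cone in the orthant by nearby ones moves its directions little. -/
theorem exists_mem_cone_norm_sub_le {w w' : Fin m → Vec d} {r σ : ℝ} (hr : 0 < r)
    (hw : ∀ k, r ≤ coordSum (w k)) (hw0 : ∀ k i, 0 ≤ w' k i) (hw0' : ∀ k, w' k ≠ 0)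
    (hclose : ∀ k, ‖w' k - w k‖ ≤ σ) {v : Vec d} (hv : v ∈ cone w) (hv0 : v ≠ 0) :
    ∃ v' ∈ cone w', ‖v'‖ = 1 ∧ ‖v' - toSphere v‖ ≤ 2 * d / r * σ := by
  obtain ⟨c, hc, rfl⟩ := hv
  set v := ∑ k, c k • w k with hv
  set v' := ∑ k, c k • w' k with hv'
  have hv'C : v' ∈ cone w' := ⟨c, hc, rfl⟩
  have hvn := norm_pos_iff.2 hv0
  obtain ⟨k₀, hk₀⟩ : ∃ k, 0 < c k := by
    by_contra! h
    exact hv0 (Finset.sum_eq_zero fun k _ => by rw [le_antisymm (h k) (hc k), zero_smul])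
  have hv'0 : v' ≠ 0 := fun h => by
    obtain ⟨i, hi⟩ : ∃ i, w' k₀ i ≠ 0 := by
      by_contra! h
      exact hw0' k₀ (by ext i; exact h i)
    have h1 : ∑ k, c k * w' k i = 0 := by
      have := congrArg (fun x : Vec d => x i) h
      simpa [hv'] using this
    have h2 := (Finset.sum_eq_zero_iff_of_nonneg fun k _ => mul_nonneg (hc k) (hw0 k i)).1 h1 k₀
      (Finset.mem_univ _)
    exact (mul_ne_zero hk₀.ne' hi) h2
  have hv'n := norm_pos_iff.2 hv'0
  -- The linear functional `coordSum` prevents cancellation: the coefficients are controlled by the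
  -- norm of the combination, independently of `m`.
  have hsum : (∑ k, c k) * r ≤ d * ‖v‖ := by
    refine le_trans ?_ ((le_abs_self _).trans (abs_coordSum_le v))
    have : coordSum v = ∑ k, c k * coordSum (w k) := by
      simp only [coordSum, hv, WithLp.ofLp_sum, Finset.sum_apply, PiLp.smul_apply, smul_eq_mul,
        Finset.mul_sum]
      exact Finset.sum_comm
    rw [this, Finset.sum_mul]
    exact Finset.sum_le_sum fun k _ => mul_le_mul_of_nonneg_left (hw k) (hc k)
  have hdiff : ‖v' - v‖ ≤ (∑ k, c k) * σ := by
    rw [hv, hv', ← Finset.sum_sub_distrib, Finset.sum_mul]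
    refine (norm_sum_le _ _).trans (Finset.sum_le_sum fun k _ => ?_)
    rw [← smul_sub, norm_smul, Real.norm_of_nonneg (hc k)]
    exact mul_le_mul_of_nonneg_left (hclose k) (hc k)
  have hσ : 0 ≤ σ := (norm_nonneg _).trans (hclose k₀)
  refine ⟨toSphere v', cone_smul _ (inv_nonneg.2 hv'n.le) _ hv'C, by
    simp [toSphere, norm_smul, hv'0], ?_⟩
  -- Normalization adds an error no larger than the displacement itself, whence the factor `2`.
  have h1 : toSphere v' - toSphere v
      = ‖v‖⁻¹ • (v' - v) + (‖v‖⁻¹ * (‖v‖ - ‖v'‖)) • toSphere v' := by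
    have : v' = ‖v'‖ • toSphere v' := by rw [toSphere, smul_inv_smul₀ hv'n.ne']
    rw [mul_sub, inv_mul_cancel₀ hvn.ne', sub_smul, one_smul, mul_smul, ← this, toSphere, toSphere]
    module
  have h2 : ‖toSphere v' - toSphere v‖ ≤ 2 * (‖v‖⁻¹ * ‖v' - v‖) := by
    rw [h1, two_mul]
    refine (norm_add_le _ _).trans (add_le_add ?_ ?_)
    · rw [norm_smul, norm_inv, norm_norm]
    · have : ‖toSphere v'‖ = 1 := by simp [toSphere, norm_smul, hv'0]
      rw [norm_smul, this, mul_one, norm_mul, norm_inv, norm_norm]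
      refine mul_le_mul_of_nonneg_left ?_ (by positivity)
      rw [norm_sub_rev]
      exact abs_norm_sub_norm_le _ _
  refine h2.trans ?_
  calc 2 * (‖v‖⁻¹ * ‖v' - v‖) ≤ 2 * (‖v‖⁻¹ * ((∑ k, c k) * σ)) := by gcongr
    _ = 2 * (‖v‖⁻¹ * (((∑ k, c k) * r) / r * σ)) := by field_simp
    _ ≤ 2 * (‖v‖⁻¹ * ((d * ‖v‖) / r * σ)) := by gcongr
    _ = 2 * d / r * σ := by field_simp

end Cone

/-! ### Estimates for the logistic function and Bernoulli entropy -/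

section Sigmoid

/-- For `b ≤ a`, monotonicity gives one side and `sigmoid a ≤ exp (a - b) * sigmoid b` the other. -/
theorem abs_log_sigmoid_sub_le (a b : ℝ) :
    |Real.log (Real.sigmoid a) - Real.log (Real.sigmoid b)| ≤ |a - b| := by
  wlog h : b ≤ a generalizing a b
  · rw [abs_sub_comm, abs_sub_comm a]
    exact this b a (not_le.1 h).le
  have h1 : Real.log (Real.sigmoid b) ≤ Real.log (Real.sigmoid a) :=
    Real.log_le_log (Real.sigmoid_pos b) (Real.sigmoid_le h)
  have h2 : Real.sigmoid a ≤ Real.exp (a - b) * Real.sigmoid b := by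
    rw [Real.sigmoid_def, Real.sigmoid_def, ← div_eq_mul_inv, inv_eq_one_div,
      div_le_div_iff₀ (by positivity) (by positivity), mul_add (Real.exp _),
      ← Real.exp_add, mul_one, one_mul]
    have h3 : 1 ≤ Real.exp (a - b) := Real.one_le_exp (by linarith)
    have h4 : a - b + -a = -b := by ring
    rw [h4]
    linarith
  have h3 := Real.log_le_log (Real.sigmoid_pos a) h2
  rw [Real.log_mul (Real.exp_pos _).ne' (Real.sigmoid_pos b).ne', Real.log_exp] at h3
  rw [abs_of_nonneg (by linarith), abs_of_nonneg (by linarith)]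
  linarith

/-- The logistic function has a positive slope on bounded intervals. -/
theorem le_abs_sigmoid_sub {a b R : ℝ} (ha : |a| ≤ R) (hb : |b| ≤ R) :
    Real.exp (-R) / (1 + Real.exp R) ^ 2 * |a - b| ≤ |Real.sigmoid a - Real.sigmoid b| := by
  wlog h : b ≤ a generalizing a b
  · rw [abs_sub_comm, abs_sub_comm (Real.sigmoid a)]
    exact this hb ha (not_le.1 h).le
  rw [abs_le] at ha hb
  rw [abs_of_nonneg (sub_nonneg.2 h), abs_of_nonneg (sub_nonneg.2 (Real.sigmoid_le h))]
  have h1 : Real.sigmoid a - Real.sigmoid b = (Real.exp (-b) - Real.exp (-a)) /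
      ((1 + Real.exp (-a)) * (1 + Real.exp (-b))) := by
    rw [Real.sigmoid_def, Real.sigmoid_def]
    field_simp
    ring
  have h2 : Real.exp (-R) * (a - b) ≤ Real.exp (-b) - Real.exp (-a) := by
    have h3 : Real.exp (-b) = Real.exp (-a) * Real.exp (a - b) := by
      rw [← Real.exp_add]; ring_nf
    have h4 := Real.add_one_le_exp (a - b)
    have h5 : Real.exp (-R) ≤ Real.exp (-a) := Real.exp_le_exp.2 (by linarith)
    calc Real.exp (-R) * (a - b) ≤ Real.exp (-a) * (a - b) :=
          mul_le_mul_of_nonneg_right h5 (by linarith)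
      _ ≤ Real.exp (-a) * (Real.exp (a - b) - 1) := mul_le_mul_of_nonneg_left (by linarith) (Real.exp_pos _).le
      _ = _ := by rw [h3]; ring
  have h6 : (1 + Real.exp (-a)) * (1 + Real.exp (-b)) ≤ (1 + Real.exp R) ^ 2 := by
    rw [sq]
    gcongr <;> linarith
  rw [h1, div_mul_eq_mul_div]
  exact div_le_div₀ (by rw [sub_nonneg]; exact Real.exp_le_exp.2 (by linarith)) h2
    (by positivity) h6

/-- Apply `log x ≤ x - 1` to `x = √q / √p`: relative entropy dominates the squared Hellinger
distance term by term. -/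
theorem mul_log_sub_log_ge {p q : ℝ} (hp : 0 < p) (hq : 0 < q) :
    2 * p - 2 * (√p * √q) ≤ p * (Real.log p - Real.log q) := by
  have hp' := Real.sqrt_pos.2 hp
  have hq' := Real.sqrt_pos.2 hq
  have h1 := Real.log_le_sub_one_of_pos (div_pos hq' hp')
  rw [Real.log_div hq'.ne' hp'.ne', Real.log_sqrt hp.le, Real.log_sqrt hq.le] at h1
  have h2 := mul_le_mul_of_nonneg_left h1 hp.le
  have h3 : p * (√q / √p - 1) = √p * √q - p := by
    nth_rewrite 1 [← Real.mul_self_sqrt hp.le]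
    rw [mul_sub, mul_assoc, mul_div_cancel₀ _ hp'.ne', mul_one, Real.mul_self_sqrt hp.le]
  linarith

/-- A lower bound for the relative entropy of two Bernoulli distributions. -/
theorem half_sq_sub_le_bernoulli_entropy {p q : ℝ} (hp : 0 < p) (hp1 : p < 1) (hq : 0 < q)
    (hq1 : q < 1) : (p - q) ^ 2 / 2 ≤ p * (Real.log p - Real.log q) +
      (1 - p) * (Real.log (1 - p) - Real.log (1 - q)) := by
  -- The right side is `(√a - √b) ^ 2`, and `√a + √b ≤ 2`. Adding the cases of `p, q` and of their
  -- complements yields the factor `1 / 2`.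
  have key : ∀ a b : ℝ, 0 ≤ a → a ≤ 1 → 0 ≤ b → b ≤ 1 →
      (a - b) ^ 2 / 4 ≤ a + b - 2 * (√a * √b) := fun a b ha ha1 hb hb1 => by
    have h1 := Real.mul_self_sqrt ha
    have h2 := Real.mul_self_sqrt hb
    have h3 : a - b = (√a - √b) * (√a + √b) := by linear_combination h2 - h1
    have h4 : (√a + √b) ^ 2 ≤ 4 := by
      have := Real.sqrt_le_one.2 ha1
      have := Real.sqrt_le_one.2 hb1
      have := Real.sqrt_nonneg a
      have := Real.sqrt_nonneg b
      nlinarith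
    have h5 : a + b - 2 * (√a * √b) = (√a - √b) ^ 2 := by linear_combination -h1 - h2
    rw [h5, h3, mul_pow, div_le_iff₀ (by norm_num)]
    exact mul_le_mul_of_nonneg_left h4 (sq_nonneg _)
  have h1 := mul_log_sub_log_ge hp hq
  have h2 := mul_log_sub_log_ge (sub_pos.2 hp1) (sub_pos.2 hq1)
  have h3 := key p q hp.le hp1.le hq.le hq1.le
  have h4 := key (1 - p) (1 - q) (by linarith) (by linarith) (by linarith) (by linarith)
  have h5 : (1 - p - (1 - q)) ^ 2 = (p - q) ^ 2 := by ring
  rw [h5] at h4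
  linarith

end Sigmoid

/-! ### Concentration of empirical frequencies -/

section Frequencies

/-- The empirical frequency of `z` in the sample `D`. -/
def empiricalFreq {Z : Type*} [DecidableEq Z] {N : ℕ} (D : Fin N → Z) (z : Z) : ℝ :=
  (1 / (N : ℝ)) * ∑ i, if D i = z then 1 else 0

theorem sum_empiricalFreq_mul {Z : Type*} [Fintype Z] [DecidableEq Z] {N : ℕ} (D : Fin N → Z)
    (f : Z → ℝ) : ∑ z, empiricalFreq D z * f z = (1 / (N : ℝ)) * ∑ i, f (D i) := by
  simp only [empiricalFreq, mul_assoc, Finset.sum_mul, ite_mul, one_mul, zero_mul]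
  rw [← Finset.mul_sum, Finset.sum_comm]
  simp

/-- Hoeffding's inequality for i.i.d. samples of a function with range in an interval of
length one. -/
theorem hoeffding_pi {Z : Type*} [MeasurableSpace Z] {P : Measure Z} [IsProbabilityMeasure P]
    {f : Z → ℝ} (hf : Measurable f) {a : ℝ} (hfa : ∀ z, f z ∈ Set.Icc a (a + 1)) {N : ℕ}
    (hN : 0 < N) {σ : ℝ} (hσ : 0 ≤ σ) :
    (Measure.pi fun _ : Fin N => P) {D | σ ≤ (1 / (N : ℝ)) * ∑ i, f (D i) - ∫ z, f z ∂P} ≤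
      ENNReal.ofReal (Real.exp (-(2 * N * σ ^ 2))) := by
  set μ := Measure.pi fun _ : Fin N => P
  have hN' : (0 : ℝ) < N := by exact_mod_cast hN
  have hind : iIndepFun (fun (i : Fin N) (D : Fin N → Z) => f (D i) - ∫ z, f z ∂P) μ :=
    iIndepFun_pi (X := fun _ z => f z - ∫ z, f z ∂P) fun _ => (hf.sub_const _).aemeasurable
  have hsub : ∀ i ∈ (Finset.univ : Finset (Fin N)),
      HasSubgaussianMGF (fun D : Fin N → Z => f (D i) - ∫ z, f z ∂P) (1 / 4) μ := fun i _ => by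
    have h := hasSubgaussianMGF_of_mem_Icc (μ := μ) (X := fun D : Fin N → Z => f (D i))
      (a := a) (b := a + 1) (hf.comp (measurable_pi_apply i)).aemeasurable (.of_forall fun D => hfa (D i))
    have h1 : ∫ D, f (D i) ∂μ = ∫ z, f z ∂P :=
      integral_comp_eval (μ := fun _ : Fin N => P) (i := i) hf.aestronglyMeasurable
    -- A range of length one has variance proxy `1 / 4`, which produces the exponent `2 * N * σ ^
    -- 2`.
    have h2 : ((‖a + 1 - a‖₊ / 2) ^ 2 : NNReal) = 1 / 4 := by
      rw [add_sub_cancel_left, nnnorm_one]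
      norm_num
    rwa [h1, h2] at h
  have h := HasSubgaussianMGF.measure_sum_ge_le_of_iIndepFun hind hsub
    (ε := N * σ) (by positivity)
  have hset : {D : Fin N → Z | σ ≤ (1 / (N : ℝ)) * ∑ i, f (D i) - ∫ z, f z ∂P}
      = {D | N * σ ≤ ∑ i, (f (D i) - ∫ z, f z ∂P)} := by
    ext D
    simp only [Set.mem_ofPred_eq, Finset.sum_sub_distrib, Finset.sum_const, Finset.card_univ,
      Fintype.card_fin, nsmul_eq_mul]
    rw [← mul_le_mul_iff_right₀ hN', mul_sub, ← mul_assoc, mul_one_div_cancel hN'.ne', one_mul]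
  rw [hset, ← ofReal_measureReal]
  refine ENNReal.ofReal_le_ofReal (h.trans_eq ?_)
  congr 1
  simp
  field_simp
  norm_num

/-- The two tails come from the indicator of `z`, with range in `[0, 1]`, and its negative, with
range in `[-1, 0]`. -/
theorem measure_empiricalFreq_deviation_le {Z : Type*} [MeasurableSpace Z]
    [MeasurableSingletonClass Z] [DecidableEq Z] {P : Measure Z} [IsProbabilityMeasure P] {N : ℕ}
    (hN : 0 < N) {σ : ℝ} (hσ : 0 ≤ σ) (z : Z) :
    (Measure.pi fun _ : Fin N => P) {D | σ < |empiricalFreq D z - P.real {z}|} ≤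
      ENNReal.ofReal (2 * Real.exp (-(2 * N * σ ^ 2))) := by
  have hm : Measurable fun y : Z => if y = z then (1 : ℝ) else 0 :=
    Measurable.ite (measurableSet_singleton z) measurable_const measurable_const
  have hint : ∫ y, (if y = z then (1 : ℝ) else 0) ∂P = P.real {z} := by
    have h : (fun y : Z => if y = z then (1 : ℝ) else 0) = Set.indicator {z} 1 := by
      ext y
      simp [Set.indicator_apply]
    rw [h, integral_indicator_one (measurableSet_singleton z)]
  have h1 := hoeffding_pi (P := P) hm (a := 0) (fun y => by split_ifs <;> simp) hN hσ
  have h2 := hoeffding_pi (P := P) hm.neg (a := -1)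
    (fun y => by by_cases h : y = z <;> simp [h]) hN hσ
  simp only [Pi.neg_apply, integral_neg, Finset.sum_neg_distrib, hint] at h1 h2
  rw [two_mul, ENNReal.ofReal_add (Real.exp_pos _).le (Real.exp_pos _).le]
  refine le_trans (measure_mono fun D hD => ?_) ((measure_union_le _ _).trans (add_le_add h1 h2))
  rw [Set.mem_ofPred_eq] at hD
  rcases lt_abs.1 hD with h | h
  · exact .inl h.le
  · refine .inr ?_
    simp only [empiricalFreq, Set.mem_ofPred_eq] at h ⊢
    linarith

end Frequencies

/-! ### Consistency of the logistic-regression estimates -/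

section LogisticRegression

variable {S A : Type*} [Fintype S] [Fintype A] {d : ℕ} {M : MOMDP S A d} {T J : ℕ}

theorem prefProb_eq_sigmoid (η : ℝ) (w : Vec d) (q : Query M T) :
    prefProb η w q = Real.sigmoid (η * inner ℝ w q.diff) := by
  have h1 : η * inner ℝ w q.sndRet = η * inner ℝ w q.fstRet + -(η * inner ℝ w q.diff) := by
    rw [Query.diff, inner_sub_right]
    ring
  have h2 := Real.exp_pos (η * inner ℝ w q.fstRet)
  rw [prefProb, Real.sigmoid_def, h1, Real.exp_add, ← mul_one_add, div_mul_cancel_left₀ h2.ne']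

theorem abs_smul_inner_sub_le {η B : ℝ} (hη : 0 ≤ η) {q : Query M T} (hq : ‖q.diff‖ ≤ B)
    (w w' : Vec d) : |η * inner ℝ w q.diff - η * inner ℝ w' q.diff| ≤ η * B * ‖w - w'‖ := by
  rw [← mul_sub, ← inner_sub_left, abs_mul, abs_of_nonneg hη, mul_assoc, mul_comm B]
  exact mul_le_mul_of_nonneg_left ((abs_real_inner_le_norm _ _).trans
    (mul_le_mul_of_nonneg_left hq (norm_nonneg _))) hη

/-- The logistic loss of a single comparison. -/
def comparisonLoss (η : ℝ) (q : Fin J → Query M T) (w : Vec d) (z : Comparison J) : ℝ :=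
  -(if z.2 then Real.log (prefProb η w (q z.1)) else Real.log (1 - prefProb η w (q z.1)))

/-- Bounding the fluctuation of the excess loss by a multiple of `‖w - w'‖` is what later yields an
error of order `σ` rather than `√σ`. -/
theorem abs_comparisonLoss_sub_le {η B : ℝ} (hη : 0 ≤ η) {q : Fin J → Query M T}
    (hq : ∀ j, ‖(q j).diff‖ ≤ B) (w w' : Vec d) (z : Comparison J) :
    |comparisonLoss η q w z - comparisonLoss η q w' z| ≤ η * B * ‖w - w'‖ := by
  have h := abs_smul_inner_sub_le hη (hq z.1) w w'
  simp only [comparisonLoss, prefProb_eq_sigmoid, ← Real.sigmoid_neg]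
  split_ifs
  · rw [neg_sub_neg]
    exact (abs_log_sigmoid_sub_le _ _).trans (by rwa [abs_sub_comm])
  · rw [neg_sub_neg]
    exact (abs_log_sigmoid_sub_le _ _).trans (by rwa [neg_sub_neg])

/-- The loss sees the sample only through finitely many frequencies, so their deviations control it
uniformly in `w`. -/
theorem logisticLoss_eq_sum (η : ℝ) (q : Fin J → Query M T) {N : ℕ} (D : Fin N → Comparison J)
    (w : Vec d) :
    logisticLoss η q D w = ∑ z, empiricalFreq D z * comparisonLoss η q w z := by
  rw [sum_empiricalFreq_mul]
  rfl

instance isProbabilityMeasure_comparisonLaw (η : ℝ) (q : Fin J → Query M T) (ν : PMF (Fin J))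
    (w : Vec d) : IsProbabilityMeasure (comparisonLaw η q ν w) := by
  constructor
  have h := ν.tsum_coe
  rw [tsum_fintype] at h
  simpa [comparisonLaw] using h

theorem comparisonLaw_real_singleton (η : ℝ) (q : Fin J → Query M T) (ν : PMF (Fin J))
    (w : Vec d) (j : Fin J) (b : Bool) :
    (comparisonLaw η q ν w).real {(j, b)} =
      (ν j).toReal * if b then prefProb η w (q j) else 1 - prefProb η w (q j) := by
  have h1 : comparisonLaw η q ν w {(j, b)} = ν j * bernoulliMeasure true false
      ⟨prefProb η w (q j), prefProb_mem η w (q j)⟩ {b} := by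
    rw [comparisonLaw, Measure.finsetSum_apply, Finset.sum_eq_single j]
    · rw [← Set.singleton_prod_singleton, Measure.smul_apply, Measure.prod_prod]
      simp
    · intro j' _ hj'
      rw [← Set.singleton_prod_singleton, Measure.smul_apply, Measure.prod_prod]
      simp [hj']
    · simp
  rw [Measure.real, h1, ENNReal.toReal_mul]
  congr 1
  cases b <;> simp

/-- Averaging a function over the law of one comparison. -/
theorem sum_comparisonLaw_mul (η : ℝ) (q : Fin J → Query M T) (ν : PMF (Fin J)) (w : Vec d)
    (f : Comparison J → ℝ) :
    ∑ z, (comparisonLaw η q ν w).real {z} * f z = ∑ j, (ν j).toReal *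
      (prefProb η w (q j) * f (j, true) + (1 - prefProb η w (q j)) * f (j, false)) := by
  rw [Fintype.sum_prod_type]
  refine Finset.sum_congr rfl fun j _ => ?_
  rw [Fintype.sum_bool, comparisonLaw_real_singleton, comparisonLaw_real_singleton]
  simp only [if_true, Bool.false_eq_true, if_false]
  ring

/-- The second moment of spanning query differences is positive definite. -/
theorem exists_pos_mul_sq_le_sum {J : ℕ} (ν : PMF (Fin J)) (Δ : Fin J → Vec d)
    (hspan : Submodule.span ℝ {x : Vec d | ∃ j ∈ ν.support, x = Δ j} = ⊤) :
    ∃ l : ℝ, 0 < l ∧ ∀ h : Vec d, l * ‖h‖ ^ 2 ≤ ∑ j, (ν j).toReal * (inner ℝ h (Δ j)) ^ 2 := by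
  set g : Vec d → ℝ := fun h => ∑ j, (ν j).toReal * (inner ℝ h (Δ j)) ^ 2 with hg
  have hg0 : ∀ h, 0 ≤ g h := fun h =>
    Finset.sum_nonneg fun j _ => mul_nonneg ENNReal.toReal_nonneg (sq_nonneg _)
  have hpos : ∀ h : Vec d, h ≠ 0 → 0 < g h := fun h hh => by
    refine (hg0 h).lt_of_ne fun h0 => hh ?_
    have h1 := (Finset.sum_eq_zero_iff_of_nonneg fun j _ =>
      mul_nonneg ENNReal.toReal_nonneg (sq_nonneg _)).1 h0.symm
    have h2 : Submodule.span ℝ {x : Vec d | ∃ j ∈ ν.support, x = Δ j} ≤ (innerSL ℝ h).ker := by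
      rw [Submodule.span_le]
      rintro _ ⟨j, hj, rfl⟩
      have h3 := h1 j (Finset.mem_univ j)
      rcases mul_eq_zero.1 h3 with h4 | h4
      · exact absurd h4 (ENNReal.toReal_ne_zero.2 ⟨(ν.mem_support_iff j).1 hj, ν.apply_ne_top j⟩)
      · simpa using pow_eq_zero_iff two_ne_zero |>.1 h4
    rw [hspan] at h2
    have h3 : innerSL ℝ h h = 0 := h2 Submodule.mem_top
    simpa using h3
  have hgc : Continuous g := by
    rw [hg]
    fun_prop
  -- The sphere is empty when `d = 0`; otherwise the minimum over the compact sphere is the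
  -- constant.
  rcases (Metric.sphere (0 : Vec d) 1).eq_empty_or_nonempty with he | hne
  · refine ⟨1, one_pos, fun h => ?_⟩
    have h0 : h = 0 := by
      by_contra hh
      have : ‖h‖⁻¹ • h ∈ Metric.sphere (0 : Vec d) 1 := by simp [norm_smul, hh]
      simp [he] at this
    simp [h0]
  · obtain ⟨x, hx, hmin⟩ := (isCompact_sphere (0 : Vec d) 1).exists_isMinOn hne hgc.continuousOn
    have hx0 : x ≠ 0 := fun h => by simp [h] at hx
    refine ⟨g x, hpos x hx0, fun h => ?_⟩
    by_cases hh : h = 0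
    · simp [hh]
    have hn := norm_pos_iff.2 hh
    have h1 : g x ≤ g (‖h‖⁻¹ • h) := hmin (by simp [norm_smul, hh])
    have h2 : g h = g (‖h‖⁻¹ • h) * ‖h‖ ^ 2 := by
      simp only [hg, Finset.sum_mul, real_inner_smul_left]
      refine Finset.sum_congr rfl fun j _ => ?_
      field_simp
    change _ ≤ g h
    rw [h2]
    exact mul_le_mul_of_nonneg_right h1 (by positivity)

/-- The expected logistic loss grows quadratically away from the latent direction. -/
theorem exists_quadratic_growth {η B R : ℝ} (hη : 0 < η) (q : Fin J → Query M T)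
    (hq : ∀ j, ‖(q j).diff‖ ≤ B) (ν : PMF (Fin J))
    (hspan : Submodule.span ℝ {x : Vec d | ∃ j ∈ ν.support, x = (q j).diff} = ⊤) :
    ∃ c : ℝ, 0 < c ∧ ∀ w w' : Vec d, ‖w‖ ≤ R → ‖w'‖ ≤ R →
      c * ‖w' - w‖ ^ 2 ≤ ∑ z, (comparisonLaw η q ν w).real {z} *
        (comparisonLoss η q w' z - comparisonLoss η q w z) := by
  obtain ⟨l, hl, hlam⟩ := exists_pos_mul_sq_le_sum ν (fun j => (q j).diff) hspan
  set r := η * (R * B)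
  set κ := Real.exp (-r) / (1 + Real.exp r) ^ 2
  have hκ : 0 < κ := by positivity
  -- All logits lie in `[-r, r]`, where `κ` bounds the slope of the logistic function from below; `1
  -- / 2` comes from the entropy bound and `l` from the second moment.
  refine ⟨(κ * η) ^ 2 / 2 * l, by positivity, fun w w' hw hw' => ?_⟩
  have hb : ∀ x : Vec d, ‖x‖ ≤ R → ∀ j, |η * inner ℝ x (q j).diff| ≤ r := fun x hx j => by
    rw [abs_mul, abs_of_pos hη]
    refine mul_le_mul_of_nonneg_left ((abs_real_inner_le_norm _ _).trans ?_) hη.le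
    exact mul_le_mul hx (hq j) (norm_nonneg _) ((norm_nonneg _).trans hx)
  rw [sum_comparisonLaw_mul, mul_assoc]
  refine (mul_le_mul_of_nonneg_left (hlam _) (by positivity)).trans ?_
  rw [Finset.mul_sum]
  refine Finset.sum_le_sum fun j _ => ?_
  rw [mul_left_comm]
  refine mul_le_mul_of_nonneg_left ?_ ENNReal.toReal_nonneg
  have h1 := le_abs_sigmoid_sub (hb w hw j) (hb w' hw' j)
  have h2 := half_sq_sub_le_bernoulli_entropy (Real.sigmoid_pos (η * inner ℝ w (q j).diff))
    (Real.sigmoid_lt_one _) (Real.sigmoid_pos (η * inner ℝ w' (q j).diff)) (Real.sigmoid_lt_one _)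
  simp only [comparisonLoss, prefProb_eq_sigmoid, if_true, Bool.false_eq_true, if_false,
    neg_sub_neg]
  refine le_trans ?_ h2
  have h3 := pow_le_pow_left₀ (by positivity) h1 2
  rw [sq_abs, mul_pow, sq_abs, ← mul_sub, ← inner_sub_left, ← neg_sub w' w, inner_neg_left] at h3
  rw [inner_sub_left] at h3 ⊢
  linarith

/-- When the empirical frequencies are close to their expectations, the logistic-regression
estimate is close to the latent direction. -/
theorem exists_norm_logisticEstimate_sub_le {η B : ℝ} (hη : 0 < η) (hB : 0 < B)
    {W : Set (Vec d)} (hW : Bornology.IsBounded W) (q : Fin J → Query M T)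
    (hq : ∀ j, ‖(q j).diff‖ ≤ B) (ν : PMF (Fin J))
    (hspan : Submodule.span ℝ {x : Vec d | ∃ j ∈ ν.support, x = (q j).diff} = ⊤) :
    ∃ L : ℝ, 0 < L ∧ ∀ w ∈ W, ∀ (N : ℕ) (D : Fin N → Comparison J) (w' : Vec d),
      IsLogisticEstimate η q W D w' → ∀ σ : ℝ,
      (∀ z, |empiricalFreq D z - (comparisonLaw η q ν w).real {z}| ≤ σ) → ‖w' - w‖ ≤ L * σ := by
  obtain ⟨R, hR⟩ := hW.exists_norm_le
  obtain ⟨c, hc, hgrowth⟩ := exists_quadratic_growth (R := R) hη q hq ν hspan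
  set n : ℝ := (Fintype.card (Comparison J) : ℝ)
  refine ⟨(n + 1) * (η * B) / c, by positivity, fun w hw N D w' hw' σ hσ => ?_⟩
  obtain ⟨hw'W, hmin⟩ := hw'
  have h1 := hgrowth w w' (hR w hw) (hR w' hw'W)
  have h2 := hmin w hw
  rw [logisticLoss_eq_sum, logisticLoss_eq_sum, ← sub_nonpos, ← Finset.sum_sub_distrib] at h2
  -- The empirical excess loss of a minimizer is nonpositive, so subtracting it from the expected
  -- excess only increases the bound and leaves a sum of frequency deviations.
  have h3 : c * ‖w' - w‖ ^ 2 ≤ ∑ _z : Comparison J, σ * (η * B * ‖w' - w‖) := by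
    calc c * ‖w' - w‖ ^ 2 ≤ ∑ z, (comparisonLaw η q ν w).real {z} *
            (comparisonLoss η q w' z - comparisonLoss η q w z) -
          ∑ z, (empiricalFreq D z * comparisonLoss η q w' z -
            empiricalFreq D z * comparisonLoss η q w z) := by linarith
      _ ≤ _ := by
        rw [← Finset.sum_sub_distrib]
        refine Finset.sum_le_sum fun z _ => ?_
        rw [← mul_sub, ← sub_mul]
        refine (le_abs_self _).trans ?_
        rw [abs_mul, abs_sub_comm ((comparisonLaw η q ν w).real {z})]
        exact mul_le_mul (hσ z) (abs_comparisonLoss_sub_le hη.le hq w' w z) (abs_nonneg _)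
          ((abs_nonneg _).trans (hσ z))
  rw [Finset.sum_const, nsmul_eq_mul, Finset.card_univ] at h3
  have hz : Nonempty (Comparison J) := ⟨(ν.support_nonempty.some, true)⟩
  have hσ0 : 0 ≤ σ := (abs_nonneg _).trans (hσ hz.some)
  rcases (norm_nonneg (w' - w)).eq_or_lt with h0 | h0
  · rw [← h0]
    positivity
  · rw [div_mul_eq_mul_div, le_div_iff₀ hc]
    -- One factor of the distance cancels, quadratic against linear.
    have h4 : c * ‖w' - w‖ ≤ n * (σ * (η * B)) := by
      refine le_of_mul_le_mul_right ?_ h0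
      linarith
    have h5 : 0 ≤ σ * (η * B) := by positivity
    linarith

instance isProbabilityMeasure_datasetLaw (η : ℝ) (q : Fin J → Query M T) (ν : PMF (Fin J))
    (N : ℕ) {m : ℕ} (w : Fin m → Vec d) : IsProbabilityMeasure (datasetLaw η q ν N w) := by
  unfold datasetLaw
  infer_instance

/-- The probability that some empirical frequency of some subset of the data is off by more
than `σ`. -/
theorem datasetLaw_deviation_le (η : ℝ) (q : Fin J → Query M T) (ν : PMF (Fin J)) {N m : ℕ}
    (hN : 0 < N) (w : Fin m → Vec d) {σ : ℝ} (hσ : 0 ≤ σ) :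
    datasetLaw η q ν N w {D | ∃ k z,
      σ < |empiricalFreq (D k) z - (comparisonLaw η q ν (w k)).real {z}|} ≤
      ENNReal.ofReal (m * (4 * J) * Real.exp (-(2 * N * σ ^ 2))) := by
  have h1 : ∀ (k : Fin m) (z : Comparison J), datasetLaw η q ν N w
      {D | σ < |empiricalFreq (D k) z - (comparisonLaw η q ν (w k)).real {z}|} ≤
      ENNReal.ofReal (2 * Real.exp (-(2 * N * σ ^ 2))) := fun k z => by
    refine le_trans (le_of_eq ?_) (measure_empiricalFreq_deviation_le
      (P := comparisonLaw η q ν (w k)) hN hσ z)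
    exact (measurePreserving_eval (fun k => Measure.pi fun _ : Fin N => comparisonLaw η q ν (w k))
      k).measure_preimage (s := {D | σ < |empiricalFreq D z -
        (comparisonLaw η q ν (w k)).real {z}|}) MeasurableSet.of_discrete.nullMeasurableSet
  have h2 : {D : Fin m → Fin N → Comparison J | ∃ k z,
      σ < |empiricalFreq (D k) z - (comparisonLaw η q ν (w k)).real {z}|} = ⋃ k, ⋃ z,
      {D | σ < |empiricalFreq (D k) z - (comparisonLaw η q ν (w k)).real {z}|} := by
    ext D
    simp
  rw [h2]
  calc _ ≤ ∑ k, ∑ z, datasetLaw η q ν N w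
        {D | σ < |empiricalFreq (D k) z - (comparisonLaw η q ν (w k)).real {z}|} :=
        (measure_iUnion_fintype_le _ _).trans (Finset.sum_le_sum fun k _ =>
          measure_iUnion_fintype_le _ _)
    _ ≤ ∑ _k : Fin m, ∑ _z : Comparison J,
        ENNReal.ofReal (2 * Real.exp (-(2 * N * σ ^ 2))) :=
        Finset.sum_le_sum fun k _ => Finset.sum_le_sum fun z _ => h1 k z
    -- Two tails, `2 * J` labelled queries and `m` subsets.
    _ = _ := by
        simp only [Finset.sum_const, Finset.card_univ, Fintype.card_prod, Fintype.card_fin,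
          Fintype.card_bool, nsmul_eq_mul]
        rw [← ENNReal.ofReal_natCast, ← ENNReal.ofReal_natCast, ← ENNReal.ofReal_mul (by positivity),
          ← ENNReal.ofReal_mul (by positivity)]
        congr 1
        push_cast
        ring

end LogisticRegression

/-! ### Sampling from the estimated cone -/

section Recovery

variable {S A : Type*} [Fintype S] [Fintype A] {d : ℕ}

instance isZeroOrProbabilityMeasure_uniformDirection (C : Set (Vec d)) :
    IsZeroOrProbabilityMeasure (uniformDirection C) := by
  unfold uniformDirection
  infer_instance

theorem pi_uniformDirection_le_one (C : Set (Vec d)) {K : ℕ} (s : Set (Fin K → Vec d)) :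
    (Measure.pi fun _ : Fin K => uniformDirection C) s ≤ 1 := by
  refine (measure_mono (Set.subset_univ s)).trans ?_
  rw [Measure.pi_univ]
  exact Finset.prod_le_one' fun _ _ => prob_le_one

/-- The probability that sampling from a cone that approximates `C` fails to recover the front:
for each of the finitely many sets of deterministic policies that may be found, one missed
direction has to be avoided by all samples. -/
theorem pi_not_isApproxParetoFront_le [Nonempty A] (hd : 1 ≤ d) {M : MOMDP S A d} {B : ℝ}
    (hB : 1 ≤ B) (hdiff : ∀ π π' : Policy S A, ‖value M π - value M π'‖ ≤ B)
    {C : Set (Vec d)} (hC : ∀ u ∈ C, ∀ i, 0 ≤ u i) {m : ℕ} {w : Fin m → Vec d}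
    (hw : ∀ k i, 0 ≤ w k i) {ε : ℝ} (hε : 0 < ε) (hε1 : ε ≤ 1)
    (hclose : ∀ u ∈ C, ‖u‖ = 1 → ∃ x ∈ cone w, ‖x‖ = 1 ∧ ‖x - u‖ ≤ ε / B / 2)
    {solve : Vec d → S → A} (hsolve : ∀ x, IsValueIterationResult M x (solve x)) {K : ℕ}
    (hK : 0 < K) :
    (Measure.pi fun _ : Fin K => uniformDirection (cone w))
      {x | ¬ IsApproxParetoFront M C ε (recoveredFront M solve x)} ≤
      ENNReal.ofReal (Nat.card (Set (S → A)) *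
        Real.exp (-((ε / B / 2 / (2 * d ^ 2 * (d + 1) ^ 3)) ^ (d - 1) * K))) := by
  classical
  have hB0 : 0 < B := one_pos.trans_le hB
  -- If the uniform law degenerates to the zero measure, its product over `K > 0` factors is zero
  -- too.
  rcases eq_zero_or_isProbabilityMeasure (uniformDirection (cone w)) with h0 | hprob
  · have h1 : (Measure.pi fun _ : Fin K => uniformDirection (cone w)) Set.univ = 0 := by
      rw [h0, Measure.pi_univ]
      simp [hK.ne']
    exact (measure_mono (Set.subset_univ _)).trans (h1.trans_le zero_le)
  set ρ := ε / B / 2 with hρ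
  set p := (ρ / (2 * d ^ 2 * (d + 1) ^ 3)) ^ (d - 1)
  have hρ0 : 0 < ρ := by positivity
  have hρ1 : ρ ≤ 1 := by
    have : ε / B ≤ 1 := (div_le_one hB0).2 (hε1.trans hB)
    rw [hρ]
    linarith
  have hp : 0 ≤ p := by positivity
  -- The missed direction, and hence the ball to be avoided, depends on `F` alone and not on the
  -- samples. A sample within `ρ` of `x₀` is within `2 * ρ = ε / B` of `u`.
  have hE : ∀ F : Set (S → A), ∃ E : Set (Fin K → Vec d),
      (Measure.pi fun _ : Fin K => uniformDirection (cone w)) E ≤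
        ENNReal.ofReal (Real.exp (-(p * K))) ∧
      ∀ x : Fin K → Vec d, (∀ k, solve (x k) ∈ F) → (∃ u, IsMissedDirection M C ε F u) →
        x ∈ E := by
    intro F
    by_cases hF : ∃ u, IsMissedDirection M C ε F u
    · obtain ⟨u, hu⟩ := hF
      obtain ⟨x₀, hx₀, hx₀1, hx₀u⟩ := hclose u hu.1 hu.2.1
      refine ⟨{x | ∀ k, x k ∉ Metric.closedBall x₀ ρ}, pi_forall_notMem_le
        Metric.isClosed_closedBall.measurableSet hp (le_uniformDirection_closedBall hd
          (cone_nonneg hw) cone_add cone_smul hx₀ hx₀1 hρ0 hρ1 hprob.ne_zero) K,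
        fun x hx _ k hk => ?_⟩
      have h1 := hu.lt_norm_sub hB0 hdiff (hx k) (hsolve (x k))
      rw [mem_closedBall_iff_norm] at hk
      have h2 := norm_sub_le_norm_sub_add_norm_sub (x k) x₀ u
      rw [hρ] at hk hx₀u
      linarith
    · exact ⟨∅, by simp, fun x _ h => absurd h hF⟩
  choose E hEle hE using hE
  calc _ ≤ (Measure.pi fun _ : Fin K => uniformDirection (cone w)) (⋃ F, E F) := by
        refine measure_mono fun x hx => Set.mem_iUnion.2 ⟨Set.range fun k => solve (x k), ?_⟩
        exact hE _ x (fun k => ⟨k, rfl⟩) (exists_isMissedDirection hC hx)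
    _ ≤ ∑ F, (Measure.pi fun _ : Fin K => uniformDirection (cone w)) (E F) :=
        measure_iUnion_fintype_le _ _
    _ ≤ ∑ _F : Set (S → A), ENNReal.ofReal (Real.exp (-(p * K))) :=
        Finset.sum_le_sum fun F _ => hEle F
    _ = _ := by
        rw [Finset.sum_const, Finset.card_univ, nsmul_eq_mul, ← ENNReal.ofReal_natCast,
          ← ENNReal.ofReal_mul (by positivity), Nat.card_eq_fintype_card]

/-- By compactness, directions stay away from zero; this normalizes the generators in the cone
perturbation bound. -/
theorem IsDirectionSet.exists_pos_le_coordSum {W : Set (Vec d)} {α : ℝ}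
    (hW : IsDirectionSet W α) : ∃ r : ℝ, 0 < r ∧ ∀ w ∈ W, r ≤ coordSum w := by
  have hc : Continuous (coordSum : Vec d → ℝ) := by unfold coordSum; fun_prop
  obtain ⟨x, hx, hmin⟩ := hW.isCompact.exists_isMinOn hW.nonempty hc.continuousOn
  refine ⟨coordSum x, ?_, fun w hw => hmin hw⟩
  exact (norm_pos_iff.2 fun h => hW.zero_notMem (h ▸ hx)).trans_le (norm_le_coordSum (hW.nonneg x hx))

/-- Generators that are close to generators of an angular cover give an angular cover. -/
theorem exists_mem_cone_near {W : Set (Vec d)} {α : ℝ} (hW : IsDirectionSet W α) {r : ℝ}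
    (hr : 0 < r) (hrW : ∀ w ∈ W, r ≤ coordSum w) {m : ℕ} {w w' : Fin m → Vec d}
    (hw : ∀ k, w k ∈ W) (hw' : ∀ k, w' k ∈ W) {θ σ : ℝ}
    (hcover : ∀ u ∈ W, ∃ v ∈ cone w, v ≠ 0 ∧ InnerProductGeometry.angle u v ≤ θ)
    (hclose : ∀ k, ‖w' k - w k‖ ≤ σ) {u : Vec d} (hu : u ∈ conicExtension W) (hu1 : ‖u‖ = 1) :
    ∃ x ∈ cone w', ‖x‖ = 1 ∧ ‖x - u‖ ≤ 2 * d / r * σ + θ := by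
  obtain ⟨a, ha, u, huW, rfl⟩ := hu
  obtain ⟨v, hv, hv0, hangle⟩ := hcover u huW
  obtain ⟨x, hx, hx1, hxv⟩ := exists_mem_cone_norm_sub_le hr (fun k => hrW _ (hw k))
    (fun k => hW.nonneg _ (hw' k)) (fun k h => hW.zero_notMem (h ▸ hw' k)) hclose hv hv0
  refine ⟨x, hx, hx1, (norm_sub_le_norm_sub_add_norm_sub x (toSphere v) _).trans
    (add_le_add hxv ?_)⟩
  have hu0 : u ≠ 0 := fun h => hW.zero_notMem (h ▸ huW)
  rw [← toSphere_of_norm_eq_one hu1, toSphere_smul ha, norm_sub_rev]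
  exact (norm_toSphere_sub_toSphere_le_angle hu0 hv0).trans hangle

theorem conicExtension_nonneg {W : Set (Vec d)} {α : ℝ} (hW : IsDirectionSet W α) :
    ∀ u ∈ conicExtension W, ∀ i, 0 ≤ u i := by
  rintro _ ⟨a, ha, u, hu, rfl⟩ i
  exact mul_nonneg ha.le (hW.nonneg u hu i)

theorem nat_pos_of_cover {W : Set (Vec d)} {α : ℝ} (hW : IsDirectionSet W α) {m : ℕ}
    {w : Fin m → Vec d} {θ : ℝ}
    (hcover : ∀ u ∈ W, ∃ v ∈ cone w, v ≠ 0 ∧ InnerProductGeometry.angle u v ≤ θ) : 0 < m := by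
  obtain ⟨u, hu⟩ := hW.nonempty
  obtain ⟨_, ⟨c, -, rfl⟩, h0, -⟩ := hcover u hu
  rcases Nat.eq_zero_or_pos m with rfl | h
  · simp at h0
  · exact h

/-- A union bound over `n` events of probability `exp (-a)`. -/
theorem mul_exp_neg_le {n x δ a : ℝ} (hn : 1 ≤ n) (hx : 1 ≤ x) (hδ : 0 < δ) (hδ1 : δ ≤ 1)
    (ha : (1 + Real.log (2 * n)) * (1 + Real.log (x / δ)) ≤ a) :
    n * x * Real.exp (-a) ≤ δ / 2 := by
  have h1 : 0 ≤ Real.log (2 * n) := Real.log_nonneg (by linarith)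
  have h2 : 0 ≤ Real.log (x / δ) := Real.log_nonneg ((one_le_div hδ).2 (hδ1.trans hx))
  -- The product of the two factors dominates the sum of logarithms, so the constant part can be
  -- absorbed into `C₁` or `C₂`.
  have h3 : Real.log (2 * n) + Real.log (x / δ) ≤ a := by nlinarith
  have hn0 : 0 < n := one_pos.trans_le hn
  have hx0 : 0 < x := one_pos.trans_le hx
  rw [← Real.log_mul (by positivity) (by positivity), Real.log_le_iff_le_exp (by positivity)] at h3
  rw [Real.exp_neg, ← div_eq_mul_inv, div_le_iff₀ (Real.exp_pos a)]
  calc n * x = δ / 2 * (2 * n * (x / δ)) := by field_simp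
    _ ≤ _ := mul_le_mul_of_nonneg_left h3 (by positivity)

end Recovery

end MOIRL

end

/-! ### Choice of constants and conclusion -/

theorem proposition7p1 (S A : Type*) [Fintype S] [Nonempty S] [Fintype A] [Nonempty A]
    (d : ℕ) (hd : 1 ≤ d) (B : ℝ) (hB : 0 < B) :
    ∃ C₁ c₀ : ℝ, 0 < C₁ ∧ 0 < c₀ ∧
      ∀ (M : MOIRL.MOMDP S A d) (W : Set (MOIRL.Vec d)) (α : ℝ) (T J : ℕ)
        (q : Fin J → MOIRL.Query M T) (ν : PMF (Fin J)) (η : ℝ),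
        MOIRL.IsDirectionSet W α →
        (∀ q' : MOIRL.Query M T, ‖q'.diff‖ ≤ B) →
        0 < η →
        Submodule.span ℝ {x : MOIRL.Vec d | ∃ j ∈ ν.support, x = (q j).diff} = ⊤ →
        ∃ C₂ : ℝ, 0 < C₂ ∧
          ∀ (ε δ : ℝ), 0 < ε → ε ≤ 1 → 0 < δ → δ < 1 →
          ∀ (m : ℕ) (w : Fin m → MOIRL.Vec d), (∀ k, w k ∈ W) →
          (∀ u ∈ W, ∃ v ∈ MOIRL.cone w, v ≠ 0 ∧ InnerProductGeometry.angle u v ≤ c₀ * ε) →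
          ∀ N : ℕ, C₂ * (1 + Real.log (m / δ)) / ε ^ 2 ≤ N →
          ∀ est : (Fin m → Fin N → MOIRL.Comparison J) → Fin m → MOIRL.Vec d,
          (∀ D k, MOIRL.IsLogisticEstimate η q W (D k) (est D k)) →
          ∀ solve : MOIRL.Vec d → S → A,
          (∀ x, MOIRL.IsValueIterationResult M x (solve x)) →
          ∀ K : ℕ, C₁ * (1 / ε) ^ (d - 1) * (1 + Real.log (1 / δ)) ≤ K →
            MOIRL.failureProb M (MOIRL.conicExtension W) ε (MOIRL.datasetLaw η q ν N w) est solve K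
              ≤ ENNReal.ofReal δ := by
  classical
  -- Enlarging the bound to at least `1` keeps the radius `ε / B' / 2` at most `1`.
  set B' := max 1 B with hB'
  have hB'1 : 1 ≤ B' := le_max_left _ _
  have hB'0 : 0 < B' := one_pos.trans_le hB'1
  set n : ℝ := (Nat.card (Set (S → A)) : ℝ) with hn
  have hn1 : 1 ≤ n := by
    rw [hn]
    exact_mod_cast Nat.card_pos (α := Set (S → A))
  have hd0 : (0 : ℝ) < d := by exact_mod_cast hd
  set κ : ℝ := (1 / B' / 2 / (2 * d ^ 2 * (d + 1) ^ 3)) ^ (d - 1) with hκ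
  have hκ0 : 0 < κ := by positivity
  have hlogn : 0 ≤ Real.log (2 * n) := Real.log_nonneg (by linarith)
  -- The tolerance `ε / (2 * B')` is split equally between the cover angle, giving `c₀`, and the
  -- estimation error.
  refine ⟨(1 + Real.log (2 * n)) / κ, 1 / (4 * B'), by positivity, by positivity, ?_⟩
  intro M W α T J q ν η hW hdiff hη hspan
  obtain ⟨r, hr, hrW⟩ := hW.exists_pos_le_coordSum
  obtain ⟨L, hL, hest⟩ := MOIRL.exists_norm_logisticEstimate_sub_le hη hB hW.isCompact.isBounded q
    (fun j => hdiff (q j)) ν hspan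
  have hJ : 0 < J := Fin.pos_iff_nonempty.2 ⟨ν.support_nonempty.some⟩
  have hJ1 : (1 : ℝ) ≤ J := by exact_mod_cast hJ
  -- Solves `2 * d / r * (L * s * ε) = ε / (4 * B')`, the share of the estimation error.
  set s : ℝ := r / (8 * d * L * B') with hs
  have hs0 : 0 < s := by positivity
  have hlogJ : 0 ≤ Real.log (2 * (4 * J)) := Real.log_nonneg (by linarith)
  refine ⟨(1 + Real.log (2 * (4 * J))) / (2 * s ^ 2), by positivity, ?_⟩
  intro ε δ hε hε1 hδ hδ1 m w hw hcover N hN est hestim solve hsolve K hK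
  have hm : 0 < m := MOIRL.nat_pos_of_cover hW hcover
  have hm1 : (1 : ℝ) ≤ m := by exact_mod_cast hm
  have hlogm : 0 ≤ Real.log (m / δ) := Real.log_nonneg ((one_le_div hδ).2 (hδ1.le.trans hm1))
  have hlogδ : 0 ≤ Real.log (1 / δ) := Real.log_nonneg ((one_le_div hδ).2 hδ1.le)
  have hN0 : 0 < N := by
    have : (0 : ℝ) < N := lt_of_lt_of_le (by positivity) hN
    exact_mod_cast this
  have hK0 : 0 < K := by
    have : (0 : ℝ) < K := lt_of_lt_of_le (by positivity) hK
    exact_mod_cast this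
  set bad : Set (Fin m → Fin N → MOIRL.Comparison J) := {D | ∃ k z,
    s * ε < |MOIRL.empiricalFreq (D k) z - (MOIRL.comparisonLaw η q ν (w k)).real {z}|} with hbad
  have hbadP : MOIRL.datasetLaw η q ν N w bad ≤ ENNReal.ofReal (δ / 2) := by
    refine (MOIRL.datasetLaw_deviation_le η q ν hN0 w (by positivity)).trans
      (ENNReal.ofReal_le_ofReal ?_)
    rw [mul_comm (m : ℝ)]
    refine MOIRL.mul_exp_neg_le (by linarith) hm1 hδ hδ1.le ?_
    rw [div_mul_eq_mul_div, div_div, div_le_iff₀ (by positivity)] at hN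
    linarith
  have hgood : ∀ D, D ∉ bad → (Measure.pi fun _ : Fin K =>
      MOIRL.uniformDirection (MOIRL.cone (est D))) {x | ¬ MOIRL.IsApproxParetoFront M
        (MOIRL.conicExtension W) ε (MOIRL.recoveredFront M solve x)} ≤ ENNReal.ofReal (δ / 2) := by
    intro D hD
    have hclose : ∀ k, ‖est D k - w k‖ ≤ L * (s * ε) := fun k => by
      refine hest (w k) (hw k) N (D k) (est D k) (hestim D k) (s * ε) fun z => ?_
      by_contra! h
      exact hD ⟨k, z, h⟩
    refine (MOIRL.pi_not_isApproxParetoFront_le hd hB'1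
      (fun π π' => (hdiff (.policies π π')).trans (le_max_right _ _))
      (MOIRL.conicExtension_nonneg hW) (fun k => hW.nonneg _ (hestim D k).1) hε hε1
      (fun u hu hu1 => ?_) hsolve hK0).trans (ENNReal.ofReal_le_ofReal ?_)
    · obtain ⟨x, hx, hx1, hxu⟩ := MOIRL.exists_mem_cone_near hW hr hrW hw
        (fun k => (hestim D k).1) hcover hclose hu hu1
      refine ⟨x, hx, hx1, hxu.trans_eq ?_⟩
      rw [hs]
      field_simp
      norm_num
    · have hp : (ε / B' / 2 / (2 * d ^ 2 * (d + 1) ^ 3)) ^ (d - 1) = κ * ε ^ (d - 1) := by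
        rw [hκ, ← mul_pow]
        congr 1
        ring
      have h := MOIRL.mul_exp_neg_le (n := n) (x := 1) (δ := δ) (a := κ * ε ^ (d - 1) * K) hn1
        le_rfl hδ hδ1.le ?_
      · rw [mul_one] at h
        rwa [hp]
      · calc (1 + Real.log (2 * n)) * (1 + Real.log (1 / δ)) = κ * ε ^ (d - 1) *
              ((1 + Real.log (2 * n)) / κ * (1 / ε) ^ (d - 1) * (1 + Real.log (1 / δ))) := by
              rw [one_div_pow]
              field_simp
          _ ≤ _ := mul_le_mul_of_nonneg_left hK (by positivity)
  unfold MOIRL.failureProb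
  -- Given the dataset, failure has probability at most `1` on `bad` and at most `δ / 2` elsewhere.
  calc _ ≤ ∫⁻ D, (bad.indicator (fun _ => 1) D + ENNReal.ofReal (δ / 2))
        ∂(MOIRL.datasetLaw η q ν N w) := by
        refine lintegral_mono fun D => ?_
        by_cases hD : D ∈ bad
        · rw [Set.indicator_of_mem hD]
          exact (MOIRL.pi_uniformDirection_le_one _ _).trans le_self_add
        · rw [Set.indicator_of_notMem hD, zero_add]
          exact hgood D hD
    _ ≤ ENNReal.ofReal (δ / 2) + ENNReal.ofReal (δ / 2) := by
        rw [lintegral_add_right _ measurable_const, lintegral_const, measure_univ, mul_one]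
        refine add_le_add_left ((lintegral_indicator_const_le _ _).trans ?_) _
        rwa [one_mul]
    _ = ENNReal.ofReal δ := by
        rw [← ENNReal.ofReal_add (by positivity) (by positivity), add_halves]
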